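/- Let $\lambda>0$, $\gamma>0$, $\theta_1\ge 0$, $\theta_2\ge 0$, $0<\delta\le 1$, put $\theta=\theta_1+\theta_2-\gamma$, and assume $0\le\theta\le 1$. For each integer $N\ge 1$ let $V^{(N)}=(X^{(N)},U^{(N)},Y^{(N)})$ be a continuous-time Markov chain with right-continuous paths, with values in the triples $(x,u,y)$ of non-negative integers such that $x+u+y\le N+1$, with initial state $(N,0,1)$, and with the following transitions and rates from the state $(X,U,Y)$: \[ \begin{array}{cc} (-1,0,1) & \lambda\delta XY,\\ (-1,1,0) & \lambda(1-\delta)XY,\\ (0,0,-2) & \lambda\theta_1\binom{Y}{2},\\ (0,0,-1) & \lambda\theta_2Y(Y-1)+\lambda\gamma Y(N+1-X-Y). \end{array} \] Here $X$, $U$, $Y$ are the numbers of ignorants, uninterested individuals and spreaders in a population of $N+1$ individuals. Let $\tau^{(N)}=\inf\{t: Y^{(N)}(t)=0\}$. For $x\in(0,1)$ define \[ f(x)=\begin{cases} \dfrac{(\gamma+\delta\theta)x^{\theta}-(\gamma+\delta)\theta x-\gamma(1-\theta)}{\theta(1-\theta)} & \text{if } 0<\theta<1,\\[2mm] (\gamma+\delta)(1-x)+\gamma\log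 x & \text{if } \theta=0,\\ -\gamma(1-x)-(\gamma+\delta)x\log x & \text{if } \theta=1. \end{cases} \] Then $f$ has exactly one root $x_\infty$ in $(0,1)$, and $\tau^{(N)}<\infty$ almost surely for every $N\ge 1$. With $u_\infty=(1-\delta)(1-x_\infty)$, as $N\to\infty$, \[ \frac{X^{(N)}(\tau^{(N)})}{N}\to x_\infty \quad\text{and}\quad \frac{U^{(N)}(\tau^{(N)})}{N}\to u_\infty \quad\text{in probability.} \] -/

import Mathlib

open MeasureTheory Filter Topology Set
open scoped NNReal ENNReal

noncomputable section

namespace Rumour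

/-! ## Continuous-time Markov chains on a finite state space -/

/-- The generator (Q-matrix) with off-diagonal entries `rate v w` and zero row sums. -/
def generator {S : Type*} [Fintype S] [DecidableEq S] (rate : S → S → ℝ) : Matrix S S ℝ :=
  Matrix.of fun v w => rate v w - if v = w then ∑ w', rate v w' else 0

/-- The transition function `P_t = exp (t Q)`. -/
def transitionMatrix {S : Type*} [Fintype S] [DecidableEq S] (rate : S → S → ℝ) (t : ℝ≥0) :
    Matrix S S ℝ :=
  NormedSpace.exp ((t : ℝ) • generator rate)

/-- The past up to time `s`: the sigma-algebra generated by `V r`, `r ≤ s`. -/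
abbrev past {S Ω : Type*} (V : ℝ≥0 → Ω → S) (s : ℝ≥0) : MeasurableSpace Ω :=
  ⨆ r ∈ Set.Iic s, MeasurableSpace.comap (V r) ⊤

/-- `V` is, under `μ`, a continuous-time Markov chain with almost surely right-continuous paths,
started at `v₀`, that jumps from `v` to `w ≠ v` at rate `rate v w`. -/
structure IsMarkovChain {S Ω : Type*} [Fintype S] [DecidableEq S] [MeasurableSpace Ω]
    (rate : S → S → ℝ) (v₀ : S) (μ : Measure Ω) (V : ℝ≥0 → Ω → S) : Prop where
  measurable : ∀ t v, MeasurableSet {ω | V t ω = v}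
  /-- The paths are right-continuous, for the discrete topology of the state space. -/
  right_continuous : ∀ᵐ ω ∂μ, ∀ t, ∀ᶠ s in 𝓝[≥] t, V s ω = V t ω
  initial : ∀ᵐ ω ∂μ, V 0 ω = v₀
  /-- The Markov property with transition function `P_h`. -/
  markov : ∀ (s h : ℝ≥0) (A : Set Ω), MeasurableSet[past V s] A → ∀ v w : S,
    μ (A ∩ {ω | V s ω = v} ∩ {ω | V (s + h) ω = w}) =
      μ (A ∩ {ω | V s ω = v}) * ENNReal.ofReal (transitionMatrix rate h v w)

/-! ## The general rumour model -/

/-- States of the population of `N + 1` individuals: `x` ignorants, `u` uninterested individuals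
and `y` spreaders; the remaining `N + 1 - x - u - y` individuals are the stiflers. -/
@[ext]
structure State (N : ℕ) where
  x : ℕ
  u : ℕ
  y : ℕ
  total_le : x + u + y ≤ N + 1

instance (N : ℕ) : DecidableEq (State N) := Classical.decEq _

/-- The state space is finite. -/
instance (N : ℕ) : Fintype (State N) :=
  Fintype.ofInjective
    (fun v : State N => ((⟨v.x, by have := v.total_le; omega⟩, ⟨v.u, by have := v.total_le; omega⟩,
      ⟨v.y, by have := v.total_le; omega⟩) : Fin (N + 2) × Fin (N + 2) × Fin (N + 2)))
    (fun v w h => by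
      simp only [Prod.mk.injEq, Fin.mk.injEq] at h
      exact State.ext h.1 h.2.1 h.2.2)

/-- Initially there are `N` ignorants, no uninterested individual and one spreader. -/
def initialState (N : ℕ) : State N := ⟨N, 0, 1, by omega⟩

/-- The jump rates of `(X, U, Y)`; the four summands are the transitions `(-1, 0, 1)`,
`(-1, 1, 0)`, `(0, 0, -2)` and `(0, 0, -1)`. -/
def rate (lam γ θ₁ θ₂ δ : ℝ) (N : ℕ) (v w : State N) : ℝ :=
  (if w.x + 1 = v.x ∧ w.u = v.u ∧ w.y = v.y + 1 then lam * δ * v.x * v.y else 0) +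
  (if w.x + 1 = v.x ∧ w.u = v.u + 1 ∧ w.y = v.y then lam * (1 - δ) * v.x * v.y else 0) +
  (if w.x = v.x ∧ w.u = v.u ∧ w.y + 2 = v.y then lam * θ₁ * (v.y.choose 2 : ℝ) else 0) +
  (if w.x = v.x ∧ w.u = v.u ∧ w.y + 1 = v.y then
    lam * θ₂ * v.y * ((v.y : ℝ) - 1) + lam * γ * v.y * ((N : ℝ) + 1 - v.x - v.y) else 0)

/-- `V` is a rumour chain in a population of `N + 1` individuals. -/
def IsRumourChain {Ω : Type*} [MeasurableSpace Ω] (lam γ θ₁ θ₂ δ : ℝ) (N : ℕ) (μ : Measure Ω)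
    (V : ℝ≥0 → Ω → State N) : Prop :=
  IsMarkovChain (rate lam γ θ₁ θ₂ δ N) (initialState N) μ V

/-- The absorption time `τ = inf {t : Y t = 0}`. -/
def absorptionTime {Ω : Type*} {N : ℕ} (V : ℝ≥0 → Ω → State N) (ω : Ω) : ℝ≥0 :=
  sInf {t | (V t ω).y = 0}

/-- The state `V τ` at absorption. -/
def finalState {Ω : Type*} {N : ℕ} (V : ℝ≥0 → Ω → State N) (ω : Ω) : State N :=
  V (absorptionTime V ω) ω

/-- The function of which the limiting fraction of ignorants is the root in `(0, 1)`:
`f₀` for `θ = 0`, `f₁` for `θ = 1` and `f` otherwise. -/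
def limitFun (δ γ θ x : ℝ) : ℝ :=
  if θ = 0 then (γ + δ) * (1 - x) + γ * Real.log x
  else if θ = 1 then -γ * (1 - x) - (γ + δ) * x * Real.log x
  else ((γ + δ * θ) * x ^ θ - (γ + δ) * θ * x - γ * (1 - θ)) / (θ * (1 - θ))

/-- Convergence in probability to a constant, for random variables `Z N` that may be defined on
different probability spaces. -/
def TendstoInProbability {Ω : ℕ → Type*} [∀ N, MeasurableSpace (Ω N)] (μ : ∀ N, Measure (Ω N))
    (Z : ∀ N, Ω N → ℝ) (c : ℝ) : Prop :=
  ∀ ε : ℝ, 0 < ε → Tendsto (fun N => μ N {ω | ε ≤ |Z N ω - c|}) atTop (𝓝 0)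

end Rumour

end

/-! The argument uses supermartingales only: there is no fluid limit and no time change of the
chain. Divide the generator by `lam * y`, the factor common to all rates, and write ξ = x/N, z =
(y-1)/N. The mean-field equations become ξ' = -ξ, z' = (γ+δ)ξ - γ - θz, whose orbit from (1,0) is
the graph z = f(ξ), where ξ f'(ξ) = θ f(ξ) + γ - (γ+δ)ξ and f(1) = 0. Extinction means z ≈ 0, hence
f(ξ) ≈ 0. Since f'' = -(γ+δθ)x^(θ-2) < 0 and f'(1) = -δ < 0, the only zeros of f in (0,1] are one
interior point and 1.

The potential 2x+y decreases at rate at least of order N while spreaders remain, so absorption is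
almost sure (`ae_exists_absorbed`). A nonnegative function of nonpositive drift therefore controls
the final state through its initial value (`measure_finalState_le`). Three such functions suffice.

(1) The square of u - (1-δ)(N-x), plus δ(1-δ)x, has drift zero and starts at order N, so u/N is
close to (1-δ)(1-x/N) at the end. (2) The square of y - 1 - N f(x/N) has drift at most KN, because
-θ(z-f)² ≤ 0 and the remaining terms are second-order. A multiple of 2x+y compensates KN. This
forces f(x/N) → 0 at absorption (`tendsto_measure_profile`). Near 0, f is replaced by a tangent
line, as f'' blows up there. (3) `earlyWeight` excludes the spurious zero ξ = 1: the process dies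
out with x ≥ (1-ε)N only with probability O(1/N). -/

namespace Rumour

/-! ### Expectations and supermartingale bounds for finite chains -/

section Chain

variable {S Ω : Type*} [Fintype S] [DecidableEq S]

theorem generator_mulVec (rate : S → S → ℝ) (g : S → ℝ) (v : S) :
    (generator rate).mulVec g v = ∑ w, rate v w * (g w - g v) := by
  simp only [generator, Matrix.mulVec, dotProduct, Matrix.of_apply, sub_mul, mul_sub, ite_mul,
    zero_mul, Finset.sum_sub_distrib, Finset.sum_ite_eq, Finset.mem_univ, if_true, Finset.sum_mul]

open scoped Matrix.Norms.Operator in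
theorem hasDerivAt_exp_apply (Q : Matrix S S ℝ) (v w : S) (t : ℝ) :
    HasDerivAt (fun s : ℝ => NormedSpace.exp (s • Q) v w) ((NormedSpace.exp (t • Q) * Q) v w) t := by
  have h := hasDerivAt_exp_smul_const (𝕂 := ℝ) Q t
  exact (hasDerivAt_pi.1 ((hasDerivAt_pi.1 h) v)) w

open scoped Matrix.Norms.Operator in
-- The backward equation; the preceding lemma is the forward one. This form suits absorbing states,
-- where row `v` of `Q` vanishes.
theorem hasDerivAt_exp_apply' (Q : Matrix S S ℝ) (v w : S) (t : ℝ) :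
    HasDerivAt (fun s : ℝ => NormedSpace.exp (s • Q) v w) ((Q * NormedSpace.exp (t • Q)) v w) t := by
  have h := hasDerivAt_exp_smul_const' (𝕂 := ℝ) Q t
  exact (hasDerivAt_pi.1 ((hasDerivAt_pi.1 h) v)) w

theorem hasDerivAt_exp_mulVec (Q : Matrix S S ℝ) (g : S → ℝ) (v : S) (t : ℝ) :
    HasDerivAt (fun s : ℝ => ∑ w, NormedSpace.exp (s • Q) v w * g w)
      (∑ w, NormedSpace.exp (t • Q) v w * Q.mulVec g w) t := by
  have h := HasDerivAt.fun_sum (u := Finset.univ)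
    fun w _ => (hasDerivAt_exp_apply Q v w t).mul_const (g w)
  have key : (NormedSpace.exp (t • Q)).mulVec (Q.mulVec g) v =
      (NormedSpace.exp (t • Q) * Q).mulVec g v := by
    rw [Matrix.mulVec_mulVec]
  exact h.congr_deriv key.symm

theorem sum_transitionMatrix_zero (rate : S → S → ℝ) (g : S → ℝ) (v : S) :
    ∑ w, transitionMatrix rate 0 v w * g w = g v := by
  simp [transitionMatrix, Matrix.one_apply]

theorem sum_transitionMatrix (rate : S → S → ℝ) (t : ℝ≥0) (v : S) :
    ∑ w, transitionMatrix rate t v w = 1 := by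
  have hd : ∀ s : ℝ, HasDerivAt (fun s : ℝ => ∑ w, NormedSpace.exp (s • generator rate) v w * 1)
      0 s := by
    intro s
    convert hasDerivAt_exp_mulVec (generator rate) (fun _ => 1) v s using 1
    simp [generator_mulVec]
  have h := is_const_of_deriv_eq_zero (fun s => (hd s).differentiableAt) (fun s => (hd s).deriv) t 0
  have h0 := sum_transitionMatrix_zero rate (fun _ => 1) v
  simp only [transitionMatrix, mul_one, NNReal.coe_zero] at h h0 ⊢
  rw [h, h0]

/-- The transition function does not leave a state without outgoing jumps. -/
theorem transitionMatrix_absorbing {rate : S → S → ℝ} {v : S} (hv : ∀ w, rate v w = 0)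
    (t : ℝ≥0) {w : S} (hw : w ≠ v) : transitionMatrix rate t v w = 0 := by
  have hd : ∀ s : ℝ, HasDerivAt (fun s : ℝ => NormedSpace.exp (s • generator rate) v w) 0 s := by
    intro s
    convert hasDerivAt_exp_apply' (generator rate) v w s using 1
    simp [Matrix.mul_apply, generator, hv]
  have h := is_const_of_deriv_eq_zero (fun s => (hd s).differentiableAt) (fun s => (hd s).deriv) t 0
  simp only [transitionMatrix, h]
  simp [hw.symm]

variable [MeasurableSpace Ω] {rate : S → S → ℝ} {v₀ : S} {μ : Measure Ω}
  {V : ℝ≥0 → Ω → S}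

namespace IsMarkovChain

theorem measure_setOf_eq (h : IsMarkovChain rate v₀ μ V) (t : ℝ≥0) (B : S → Prop)
    [DecidablePred B] :
    μ {ω | B (V t ω)} = ∑ w with B w, μ {ω | V t ω = w} := by
  rw [← measure_biUnion_finset]
  · congr 1
    ext ω
    simp
  · intro a _ b _ hab
    refine Set.disjoint_left.2 fun ω ha hb => hab ?_
    exact (show V t ω = a from ha).symm.trans hb
  · intro w _
    exact h.measurable t w

theorem ae_eq_of_absorbing (h : IsMarkovChain rate v₀ μ V) {v : S} (hv : ∀ w, rate v w = 0)
    {s t : ℝ≥0} (hst : s ≤ t) : ∀ᵐ ω ∂μ, V s ω = v → V t ω = v := by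
  obtain ⟨r, rfl⟩ := exists_add_of_le hst
  have h1 : ∀ᵐ ω ∂μ, ∀ w, w ≠ v → ¬ (V s ω = v ∧ V (s + r) ω = w) := by
    rw [ae_all_iff]
    intro w
    by_cases hw : w = v
    · simp [hw]
    have hm := h.markov s r univ MeasurableSet.univ v w
    rw [transitionMatrix_absorbing hv r hw, ENNReal.ofReal_zero, mul_zero, univ_inter] at hm
    filter_upwards [measure_eq_zero_iff_ae_notMem.1 hm] with ω hω _
    exact hω
  filter_upwards [h1] with ω hω hs
  by_contra hne
  exact hω _ hne ⟨hs, rfl⟩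

variable [IsProbabilityMeasure μ]

theorem measure_eq (h : IsMarkovChain rate v₀ μ V) (t : ℝ≥0) (w : S) :
    μ {ω | V t ω = w} = ENNReal.ofReal (transitionMatrix rate t v₀ w) := by
  have h0 : μ {ω | V 0 ω = v₀} = 1 := by
    rw [prob_compl_eq_zero_iff (h.measurable 0 v₀) |>.symm]
    exact h.initial
  have hm := h.markov 0 t univ MeasurableSet.univ v₀ w
  rw [zero_add, univ_inter, h0, one_mul] at hm
  rw [← hm]
  apply measure_congr
  filter_upwards [h.initial] with ω hω
  exact propext ⟨fun hw => ⟨hω, hw⟩, fun hw => hw.2⟩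

/-- No sign condition on `rate` enters. The positive parts of row `v₀` are the probabilities of the
values of `V t` and sum to 1; the entries themselves also sum to 1, so the negative parts vanish. -/
theorem transitionMatrix_nonneg (h : IsMarkovChain rate v₀ μ V) (t : ℝ≥0) (w : S) :
    0 ≤ transitionMatrix rate t v₀ w := by
  have h1 : ∑ w, ENNReal.ofReal (transitionMatrix rate t v₀ w) = 1 := by
    have := h.measure_setOf_eq t (fun _ => True)
    simp only [Set.ofPred_true, measure_univ, Finset.filter_true] at this
    rw [this]
    exact Finset.sum_congr rfl fun w _ => (h.measure_eq t w).symm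
  have h2 : ∑ w, max (transitionMatrix rate t v₀ w) 0 = 1 := by
    have := congrArg ENNReal.toReal h1
    rw [ENNReal.toReal_sum (fun _ _ => ENNReal.ofReal_ne_top)] at this
    simpa [ENNReal.toReal_ofReal'] using this
  have h3 : ∑ w, (max (transitionMatrix rate t v₀ w) 0 - transitionMatrix rate t v₀ w) = 0 := by
    rw [Finset.sum_sub_distrib, h2, sum_transitionMatrix, sub_self]
  have h4 := (Finset.sum_eq_zero_iff_of_nonneg
    (fun w _ => sub_nonneg.2 (le_max_left _ _))).1 h3 w (Finset.mem_univ w)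
  rw [← sub_eq_zero.1 h4]
  exact le_max_right _ _

/-- If `b` has nonpositive drift and `g` has drift at most `-b`, then
`E (g (V t)) + t * E (b (V t)) ≤ g v₀`. -/
theorem sum_add_mul_le (h : IsMarkovChain rate v₀ μ V) {g b : S → ℝ}
    (hb : ∀ v, ∑ w, rate v w * (b w - b v) ≤ 0)
    (hg : ∀ v, ∑ w, rate v w * (g w - g v) ≤ -b v) (t : ℝ≥0) :
    ∑ w, transitionMatrix rate t v₀ w * g w + t * ∑ w, transitionMatrix rate t v₀ w * b w
      ≤ g v₀ := by
  have hd : ∀ s : ℝ, HasDerivAt (fun s : ℝ =>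
      ∑ w, NormedSpace.exp (s • generator rate) v₀ w * g w +
        s * ∑ w, NormedSpace.exp (s • generator rate) v₀ w * b w)
      (∑ w, NormedSpace.exp (s • generator rate) v₀ w * (generator rate).mulVec g w +
        (1 * ∑ w, NormedSpace.exp (s • generator rate) v₀ w * b w +
        s * ∑ w, NormedSpace.exp (s • generator rate) v₀ w * (generator rate).mulVec b w)) s :=
    fun s => (hasDerivAt_exp_mulVec _ g v₀ s).add
      ((hasDerivAt_id s).mul (hasDerivAt_exp_mulVec _ b v₀ s))
  -- The derivative of E g + t E b is E Qg + E b + t E Qb, at most 0. Because E b decreases, t E b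
  -- can replace its time integral.
  have hanti := antitoneOn_of_deriv_nonpos (convex_Ici (0 : ℝ))
    (fun s _ => (hd s).continuousAt.continuousWithinAt)
    (fun s _ => (hd s).differentiableAt.differentiableWithinAt) (by
      intro s hs
      rw [interior_Ici] at hs
      rw [(hd s).deriv]
      have hs0 : (0 : ℝ) ≤ s := le_of_lt hs
      have hP : ∀ w, 0 ≤ NormedSpace.exp (s • generator rate) v₀ w :=
        fun w => h.transitionMatrix_nonneg ⟨s, hs0⟩ w
      have h1 : ∑ w, NormedSpace.exp (s • generator rate) v₀ w * (generator rate).mulVec g w ≤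
          ∑ w, NormedSpace.exp (s • generator rate) v₀ w * (-b w) :=
        Finset.sum_le_sum fun w _ => mul_le_mul_of_nonneg_left
          (by rw [generator_mulVec]; exact hg w) (hP w)
      have h2 : ∑ w, NormedSpace.exp (s • generator rate) v₀ w * (generator rate).mulVec b w ≤ 0 :=
        Finset.sum_nonpos fun w _ => mul_nonpos_of_nonneg_of_nonpos (hP w)
          (by rw [generator_mulVec]; exact hb w)
      simp only [mul_neg, Finset.sum_neg_distrib] at h1
      have h3 := mul_nonpos_of_nonneg_of_nonpos hs0 h2
      linarith)
  have h0 := hanti (mem_Ici.2 le_rfl) (mem_Ici.2 t.2) t.2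
  have h00 := sum_transitionMatrix_zero rate g v₀
  simp only [transitionMatrix, NNReal.coe_zero] at h00 ⊢
  simp only [zero_mul, add_zero] at h0
  rw [h00] at h0
  exact h0

/-- A nonnegative supermartingale that is at least `c` on `B` bounds the probability of `B`. -/
theorem measure_le (h : IsMarkovChain rate v₀ μ V) {g : S → ℝ} (hg0 : ∀ v, 0 ≤ g v)
    (hg : ∀ v, ∑ w, rate v w * (g w - g v) ≤ 0) {B : S → Prop} {c : ℝ} (hc : 0 < c)
    (hB : ∀ v, B v → c ≤ g v) (t : ℝ≥0) :
    μ {ω | B (V t ω)} ≤ ENNReal.ofReal (g v₀ / c) := by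
  classical
  have h1 := h.sum_add_mul_le (g := g) (b := fun _ => 0) (by simp) (by simpa using hg) t
  simp only [mul_zero, Finset.sum_const_zero, add_zero] at h1
  rw [h.measure_setOf_eq t B]
  simp only [h.measure_eq]
  rw [← ENNReal.ofReal_sum_of_nonneg (fun w _ => h.transitionMatrix_nonneg t w)]
  apply ENNReal.ofReal_le_ofReal
  rw [le_div_iff₀ hc, Finset.sum_mul]
  refine le_trans ?_ h1
  refine (Finset.sum_le_sum fun w hw => ?_).trans (Finset.sum_le_sum_of_subset_of_nonneg
    (Finset.filter_subset B Finset.univ) fun w _ _ =>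
      mul_nonneg (h.transitionMatrix_nonneg t w) (hg0 w))
  exact mul_le_mul_of_nonneg_left (hB w (Finset.mem_filter.1 hw).2) (h.transitionMatrix_nonneg t w)

/-- Markov's inequality for `b`, with t E b bounded by `g v₀`. With `b` a multiple of the indicator
of non-absorption, it gives the tail of the absorption time. -/
theorem measure_le_div_time (h : IsMarkovChain rate v₀ μ V) {g b : S → ℝ} (hg0 : ∀ v, 0 ≤ g v)
    (hb0 : ∀ v, 0 ≤ b v) (hb : ∀ v, ∑ w, rate v w * (b w - b v) ≤ 0)
    (hg : ∀ v, ∑ w, rate v w * (g w - g v) ≤ -b v) {B : S → Prop} {c : ℝ} (hc : 0 < c)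
    (hB : ∀ v, B v → c ≤ b v) {t : ℝ≥0} (ht : 0 < t) :
    μ {ω | B (V t ω)} ≤ ENNReal.ofReal (g v₀ / c / t) := by
  classical
  have h1 := h.sum_add_mul_le hb hg t
  have h2 : 0 ≤ ∑ w, transitionMatrix rate t v₀ w * g w :=
    Finset.sum_nonneg fun w _ => mul_nonneg (h.transitionMatrix_nonneg t w) (hg0 w)
  rw [h.measure_setOf_eq t B]
  simp only [h.measure_eq]
  rw [← ENNReal.ofReal_sum_of_nonneg (fun w _ => h.transitionMatrix_nonneg t w)]
  apply ENNReal.ofReal_le_ofReal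
  have ht' : (0 : ℝ) < t := ht
  rw [le_div_iff₀ ht', le_div_iff₀ hc]
  have h3 : (∑ w with B w, transitionMatrix rate t v₀ w) * c ≤
      ∑ w, transitionMatrix rate t v₀ w * b w := by
    rw [Finset.sum_mul]
    refine (Finset.sum_le_sum fun w hw => ?_).trans (Finset.sum_le_sum_of_subset_of_nonneg
      (Finset.filter_subset B Finset.univ) fun w _ _ =>
        mul_nonneg (h.transitionMatrix_nonneg t w) (hb0 w))
    exact mul_le_mul_of_nonneg_left (hB w (Finset.mem_filter.1 hw).2)
      (h.transitionMatrix_nonneg t w)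
  nlinarith [mul_le_mul_of_nonneg_left h3 ht'.le]

end IsMarkovChain

end Chain

end Rumour

namespace Rumour

/-! ### The generator of the rumour chain as an operator on functions of real variables -/

section Drift

/-- The generator applied to `G (x, u, y)`, divided by `lam * y`. -/
noncomputable def drift (γ θ₁ θ₂ δ N : ℝ) (G : ℝ → ℝ → ℝ → ℝ) (x u y : ℝ) : ℝ :=
  δ * x * (G (x - 1) u (y + 1) - G x u y) + (1 - δ) * x * (G (x - 1) (u + 1) y - G x u y) +
    θ₁ * (y - 1) / 2 * (G x u (y - 2) - G x u y) +
    (θ₂ * (y - 1) + γ * (N + 1 - x - y)) * (G x u (y - 1) - G x u y)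

theorem sum_ite_mul_of_iff {S : Type*} [Fintype S] [DecidableEq S] {P : S → Prop}
    [DecidablePred P] {s : S} (hs : ∀ w, P w ↔ w = s) (r : ℝ) (h : S → ℝ) :
    ∑ w, (if P w then r else 0) * h w = r * h s := by
  simp [hs]

theorem sum_rate_mul (lam γ θ₁ θ₂ δ : ℝ) (N : ℕ) (G : ℝ → ℝ → ℝ → ℝ) (v : State N) :
    ∑ w, rate lam γ θ₁ θ₂ δ N v w * (G w.x w.u w.y - G v.x v.u v.y) =
      lam * v.y * drift γ θ₁ θ₂ δ N G v.x v.u v.y := by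
  obtain ⟨x, u, y, hxy⟩ := v
  simp only [rate, add_mul, Finset.sum_add_distrib, drift]
  have h1 : ∑ w : State N, (if w.x + 1 = x ∧ w.u = u ∧ w.y = y + 1 then lam * δ * x * y else 0) *
      (G w.x w.u w.y - G x u y) = lam * δ * x * y * (G (x - 1) u (y + 1) - G x u y) := by
    -- At the boundary the target state does not exist, but the rate is zero there; the same split
    -- recurs below, with y = 0 and y = 1 for the pair transition.
    rcases x with _ | x
    · simp
    rw [sum_ite_mul_of_iff (s := ⟨x, u, y + 1, by omega⟩)]
    · push_cast; simp
    · intro w; rw [State.ext_iff]; simp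
  have h2 : ∑ w : State N, (if w.x + 1 = x ∧ w.u = u + 1 ∧ w.y = y then
      lam * (1 - δ) * x * y else 0) *
      (G w.x w.u w.y - G x u y) = lam * (1 - δ) * x * y * (G (x - 1) (u + 1) y - G x u y) := by
    rcases x with _ | x
    · simp
    rw [sum_ite_mul_of_iff (s := ⟨x, u + 1, y, by omega⟩)]
    · push_cast; simp
    · intro w; rw [State.ext_iff]; simp
  have h3 : ∑ w : State N, (if w.x = x ∧ w.u = u ∧ w.y + 2 = y then
      lam * θ₁ * (y.choose 2 : ℝ) else 0) *
      (G w.x w.u w.y - G x u y) = lam * θ₁ * (y.choose 2 : ℝ) * (G x u (y - 2) - G x u y) := by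
    rcases y with _ | _ | y
    · simp
    · simp
    rw [sum_ite_mul_of_iff (s := ⟨x, u, y, by omega⟩)]
    · push_cast
      rw [show (y : ℝ) + 1 + 1 - 2 = y by ring]
    · intro w; rw [State.ext_iff]; simp
  have h4 : ∑ w : State N, (if w.x = x ∧ w.u = u ∧ w.y + 1 = y then
      lam * θ₂ * y * ((y : ℝ) - 1) + lam * γ * y * ((N : ℝ) + 1 - x - y) else 0) *
      (G w.x w.u w.y - G x u y) = (lam * θ₂ * y * ((y : ℝ) - 1) +
        lam * γ * y * ((N : ℝ) + 1 - x - y)) * (G x u (y - 1) - G x u y) := by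
    rcases y with _ | y
    · simp
    rw [sum_ite_mul_of_iff (s := ⟨x, u, y, by omega⟩)]
    · push_cast; simp
    · intro w; rw [State.ext_iff]; simp
  rw [h1, h2, h3, h4, Nat.cast_choose_two]
  ring

theorem rate_eq_zero (lam γ θ₁ θ₂ δ : ℝ) {N : ℕ} {v : State N} (hv : v.y = 0) (w : State N) :
    rate lam γ θ₁ θ₂ δ N v w = 0 := by
  simp [rate, hv]

theorem rate_nonneg {lam γ θ₁ θ₂ δ : ℝ} (hlam : 0 < lam) (hγ : 0 < γ) (hθ₁ : 0 ≤ θ₁)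
    (hθ₂ : 0 ≤ θ₂) (hδ₀ : 0 < δ) (hδ₁ : δ ≤ 1) {N : ℕ} (v w : State N) :
    0 ≤ rate lam γ θ₁ θ₂ δ N v w := by
  rcases Nat.eq_zero_or_pos v.y with hv | hv
  · rw [rate_eq_zero lam γ θ₁ θ₂ δ hv]
  have hy : (1 : ℝ) ≤ v.y := by exact_mod_cast hv
  have hy' : 0 ≤ (v.y : ℝ) - 1 := by linarith
  have h1 : 0 ≤ 1 - δ := by linarith
  have h2 : 0 ≤ (N : ℝ) + 1 - v.x - v.y := by
    have : ((v.x + v.u + v.y : ℕ) : ℝ) ≤ ((N + 1 : ℕ) : ℝ) := Nat.cast_le.2 v.total_le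
    push_cast at this
    linarith [Nat.cast_nonneg (α := ℝ) v.u]
  simp only [rate]
  refine add_nonneg (add_nonneg (add_nonneg ?_ ?_) ?_) ?_ <;> split_ifs <;> positivity

/-- The drift of `2 x + y`: all jumps lower it. -/
theorem drift_potential_le {γ θ₁ θ₂ δ : ℝ} (hδ₁ : δ ≤ 1)
    (hθ₀ : 0 ≤ θ₁ + θ₂ - γ) {N x y : ℝ} (u : ℝ) (hx : 0 ≤ x) (hxN : x ≤ N) (hy : 1 ≤ y) :
    drift γ θ₁ θ₂ δ N (fun x _ y => 2 * x + y) x u y ≤ -(min 1 γ * N) := by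
  simp only [drift]
  have h1 : min 1 γ * x ≤ 1 * x := mul_le_mul_of_nonneg_right (min_le_left _ _) hx
  have h2 : min 1 γ * (N - x) ≤ γ * (N - x) :=
    mul_le_mul_of_nonneg_right (min_le_right _ _) (by linarith)
  have h3 : 0 ≤ (θ₁ + θ₂ - γ) * (y - 1) := mul_nonneg hθ₀ (by linarith)
  have h4 : 0 ≤ (1 - δ) * x := mul_nonneg (by linarith) hx
  -- The drift equals -x - (1-δ)x - θ(y-1) - γ(N-x), with θ = θ₁+θ₂-γ.
  nlinarith

end Drift

/-! ### Absorption and the law of the final state -/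

section FinalState

variable {Ω : Type*} [MeasurableSpace Ω] {lam γ θ₁ θ₂ δ : ℝ} {N : ℕ} {μ : Measure Ω}
  {V : ℝ≥0 → Ω → State N}

/-- Absorption is known almost surely only for countably many pairs of times, and τ is random.
Right-continuity makes the path constant just after τ, so a time of a countable dense set can stand
in for τ. The hypothesis at time `n` keeps the infimum away from the empty set. -/
theorem IsRumourChain.ae_finalState_eq (h : IsRumourChain lam γ θ₁ θ₂ δ N μ V) :
    ∀ᵐ ω ∂μ, ∀ n : ℕ, (V n ω).y = 0 → finalState V ω = V n ω := by
  have h1 : ∀ᵐ ω ∂μ, ∀ (v : State N) (k n : ℕ), v.y = 0 →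
      TopologicalSpace.denseSeq ℝ≥0 k ≤ n →
      V (TopologicalSpace.denseSeq ℝ≥0 k) ω = v → V n ω = v := by
    simp only [ae_all_iff]
    intro v k n hv hkn
    exact IsMarkovChain.ae_eq_of_absorbing h (rate_eq_zero _ _ _ _ _ hv) hkn
  filter_upwards [h1, IsMarkovChain.right_continuous h] with ω hω hr n hn
  unfold finalState
  set τ := absorptionTime V ω with hτ
  have hτn : τ ≤ n := csInf_le (OrderBot.bddBelow _) hn
  obtain ⟨b, hb, hI⟩ := mem_nhdsGE_iff_exists_Ico_subset.1 (hr τ)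
  have hy : (V τ ω).y = 0 := by
    obtain ⟨s, hs, hsb⟩ := exists_lt_of_csInf_lt (s := {t | (V t ω).y = 0}) ⟨_, hn⟩
      (show sInf {t | (V t ω).y = 0} < b from hb)
    have hs' : V s ω = V τ ω := hI ⟨csInf_le (OrderBot.bddBelow _) hs, hsb⟩
    rw [← hs']
    exact hs
  rcases hτn.eq_or_lt with he | hlt
  · rw [he]
  obtain ⟨s, ⟨k, rfl⟩, hs1, hs2⟩ :=
    (TopologicalSpace.denseRange_denseSeq ℝ≥0).exists_between (lt_min hlt hb)
  exact (hω (V τ ω) k n hy (hs2.le.trans (min_le_left _ _))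
    (hI ⟨hs1.le, hs2.trans_le (min_le_right _ _)⟩)).symm

variable [IsProbabilityMeasure μ]

theorem IsRumourChain.measure_pos_le (h : IsRumourChain lam γ θ₁ θ₂ δ N μ V) (hN : 1 ≤ N)
    (hlam : 0 < lam) (hγ : 0 < γ) (hθ₁ : 0 ≤ θ₁)
    (hθ₂ : 0 ≤ θ₂) (hδ₀ : 0 < δ) (hδ₁ : δ ≤ 1) (hθ₀ : 0 ≤ θ₁ + θ₂ - γ) {t : ℝ≥0} (ht : 0 < t) :
    μ {ω | (V t ω).y ≠ 0} ≤ ENNReal.ofReal ((2 * N + 1) / (lam * (min 1 γ * N)) / t) := by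
  have hN' : (0 : ℝ) < N := by exact_mod_cast hN
  have hc : 0 < lam * (min 1 γ * N) := mul_pos hlam (mul_pos (lt_min one_pos hγ) hN')
  -- `b` takes its maximum wherever a jump is possible, so its drift is nonpositive. The factor y ≥
  -- 1 in the drift of `g` is discarded.
  have := IsMarkovChain.measure_le_div_time h (g := fun v => 2 * v.x + v.y)
    (b := fun v => if v.y = 0 then 0 else lam * (min 1 γ * N)) (B := fun v => v.y ≠ 0)
    (fun v => by positivity) (fun v => by split_ifs <;> positivity) ?_ ?_ hc ?_ ht
  · simpa [initialState] using this
  · intro v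
    by_cases hv : v.y = 0
    · simp [rate_eq_zero _ _ _ _ _ hv]
    refine Finset.sum_nonpos fun w _ => mul_nonpos_of_nonneg_of_nonpos
      (rate_nonneg hlam hγ hθ₁ hθ₂ hδ₀ hδ₁ v w) ?_
    simp only [hv, if_false]
    split_ifs <;> linarith
  · intro v
    rw [sum_rate_mul lam γ θ₁ θ₂ δ N (fun x _ y => 2 * x + y) v]
    by_cases hv : v.y = 0
    · simp [hv]
    simp only [hv, if_false]
    have hy : (1 : ℝ) ≤ v.y := by exact_mod_cast Nat.one_le_iff_ne_zero.2 hv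
    have hx : (v.x : ℝ) ≤ N := by
      have := v.total_le
      exact_mod_cast (by omega : v.x ≤ N)
    have hd := drift_potential_le (γ := γ) (θ₁ := θ₁) (θ₂ := θ₂) hδ₁ hθ₀ (v.u : ℝ)
      (Nat.cast_nonneg v.x) hx hy
    have h1 := mul_le_mul_of_nonneg_left hd (by positivity : 0 ≤ lam * (v.y : ℝ))
    nlinarith [mul_le_mul_of_nonneg_left hy hc.le]
  · intro v hv
    simp [hv]

theorem tendsto_ofReal_div_natCast (a : ℝ) :
    Tendsto (fun n : ℕ => ENNReal.ofReal (a / n)) atTop (𝓝 0) := by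
  rw [← ENNReal.ofReal_zero]
  exact ENNReal.tendsto_ofReal (tendsto_const_div_atTop_nhds_zero_nat a)

theorem IsRumourChain.ae_exists_absorbed (h : IsRumourChain lam γ θ₁ θ₂ δ N μ V) (hN : 1 ≤ N)
    (hlam : 0 < lam) (hγ : 0 < γ) (hθ₁ : 0 ≤ θ₁)
    (hθ₂ : 0 ≤ θ₂) (hδ₀ : 0 < δ) (hδ₁ : δ ≤ 1) (hθ₀ : 0 ≤ θ₁ + θ₂ - γ) :
    ∀ᵐ ω ∂μ, ∃ t : ℝ≥0, (V t ω).y = 0 := by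
  refine le_antisymm (ge_of_tendsto
    (tendsto_ofReal_div_natCast ((2 * N + 1) / (lam * (min 1 γ * N)))) ?_) zero_le
  filter_upwards [eventually_ge_atTop 1] with n hn
  have h1 := h.measure_pos_le hN hlam hγ hθ₁ hθ₂ hδ₀ hδ₁ hθ₀ (t := n) (by exact_mod_cast hn)
  refine (measure_mono fun ω hω => ?_).trans h1
  exact fun h0 => hω ⟨n, h0⟩

/-- A nonnegative function of nonpositive drift that is at least `c` on the absorbed states of `B`
bounds the probability that the final state lies in `B`. -/
theorem IsRumourChain.measure_finalState_le (h : IsRumourChain lam γ θ₁ θ₂ δ N μ V) (hN : 1 ≤ N)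
    (hlam : 0 < lam) (hγ : 0 < γ) (hθ₁ : 0 ≤ θ₁)
    (hθ₂ : 0 ≤ θ₂) (hδ₀ : 0 < δ) (hδ₁ : δ ≤ 1) (hθ₀ : 0 ≤ θ₁ + θ₂ - γ)
    {G : ℝ → ℝ → ℝ → ℝ} (hG0 : ∀ v : State N, 0 ≤ G v.x v.u v.y)
    (hG : ∀ x u y : ℝ, 0 ≤ x → 1 ≤ y → x + y ≤ N + 1 → (∃ k : ℕ, y = k) →
      drift γ θ₁ θ₂ δ N G x u y ≤ 0)
    {B : State N → Prop} {c : ℝ} (hc : 0 < c) (hB : ∀ v : State N, B v → v.y = 0 →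
      c ≤ G v.x v.u v.y) :
    μ {ω | B (finalState V ω)} ≤ ENNReal.ofReal (G N 0 1 / c) := by
  -- Either the chain is absorbed by time `n`, and `V n` is the final state, or an event of
  -- probability O(1/n) occurs; `n` then tends to infinity with N fixed.
  have key : ∀ n : ℕ, 1 ≤ n → μ {ω | B (finalState V ω)} ≤ ENNReal.ofReal (G N 0 1 / c) +
      ENNReal.ofReal ((2 * N + 1) / (lam * (min 1 γ * N)) / n) := by
    intro n hn
    have h1 := h.measure_pos_le hN hlam hγ hθ₁ hθ₂ hδ₀ hδ₁ hθ₀ (t := n) (by exact_mod_cast hn)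
    have h2 := IsMarkovChain.measure_le h (g := fun v => G v.x v.u v.y)
      (B := fun v => B v ∧ v.y = 0) hG0 ?_ hc (fun v hv => hB v hv.1 hv.2) n
    · have h3 : μ {ω | B (finalState V ω)} ≤
          μ ({ω | B (V n ω) ∧ (V n ω).y = 0} ∪ {ω | (V n ω).y ≠ 0}) := by
        refine measure_mono_ae ?_
        filter_upwards [h.ae_finalState_eq] with ω hω hBω
        by_cases h0 : (V n ω).y = 0
        · refine Or.inl ⟨?_, h0⟩
          rw [← hω n h0]
          exact hBω
        · exact Or.inr h0
      refine h3.trans ((measure_union_le _ _).trans (add_le_add ?_ ?_))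
      · simpa [initialState] using h2
      · simpa using h1
    · intro v
      rw [sum_rate_mul]
      by_cases hv : v.y = 0
      · simp [hv]
      have hy : (1 : ℝ) ≤ v.y := by exact_mod_cast Nat.one_le_iff_ne_zero.2 hv
      have hx : (v.x : ℝ) + v.y ≤ N + 1 := by
        have := v.total_le
        exact_mod_cast (by omega : v.x + v.y ≤ N + 1)
      exact mul_nonpos_of_nonneg_of_nonpos (by positivity)
        (hG _ _ _ (Nat.cast_nonneg _) hy hx ⟨_, rfl⟩)
  have hlim : Tendsto (fun n : ℕ => ENNReal.ofReal (G N 0 1 / c) +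
      ENNReal.ofReal ((2 * N + 1) / (lam * (min 1 γ * N)) / n)) atTop
      (𝓝 (ENNReal.ofReal (G N 0 1 / c) + 0)) :=
    tendsto_const_nhds.add (tendsto_ofReal_div_natCast _)
  rw [add_zero] at hlim
  refine ge_of_tendsto hlim ?_
  filter_upwards [eventually_ge_atTop 1] with n hn
  exact key n hn

end FinalState

end Rumour

namespace Rumour

/-! ### Concavity, zeros and tangent continuation of the limit function -/

section LimitFun

/-- The derivative of `limitFun`, read off from the differential equation it solves. -/
noncomputable def limitDeriv (δ γ θ x : ℝ) : ℝ := (θ * limitFun δ γ θ x + γ) / x - (γ + δ)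

variable {δ γ θ : ℝ}

/-- One identity valid in all three cases of the definition, so that f'' needs no further case
distinction. -/
theorem limitFun_rpow (δ γ θ x : ℝ) :
    (1 - θ) * (θ * limitFun δ γ θ x + γ) + θ * (γ + δ) * x = (γ + δ * θ) * x ^ θ := by
  unfold limitFun
  split_ifs with h0 h1
  · simp [h0]
  · rw [h1, Real.rpow_one]
    ring
  · have h1' : 1 - θ ≠ 0 := sub_ne_zero.2 (Ne.symm h1)
    field_simp
    ring

theorem hasDerivAt_limitFun (δ γ θ : ℝ) {x : ℝ} (hx : 0 < x) :
    HasDerivAt (limitFun δ γ θ) (limitDeriv δ γ θ x) x := by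
  have hx' := hx.ne'
  by_cases h0 : θ = 0
  · have hf : limitFun δ γ θ = fun x => (γ + δ) * (1 - x) + γ * Real.log x := by
      funext x; simp [limitFun, h0]
    unfold limitDeriv
    rw [hf]
    refine ((((hasDerivAt_id x).const_sub 1).const_mul (γ + δ)).add
      ((Real.hasDerivAt_log hx').const_mul γ)).congr_deriv ?_
    rw [h0]
    field_simp
    ring
  by_cases h1 : θ = 1
  · have hf : limitFun δ γ θ = fun x => -γ * (1 - x) - (γ + δ) * x * Real.log x := by
      funext x; simp [limitFun, h1]
    unfold limitDeriv
    rw [hf]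
    refine ((((hasDerivAt_id x).const_sub 1).const_mul (-γ)).sub
      (((hasDerivAt_id x).const_mul (γ + δ)).mul (Real.hasDerivAt_log hx'))).congr_deriv ?_
    rw [h1]
    simp only [id]
    field_simp
    ring
  · have hf : limitFun δ γ θ = fun x =>
        ((γ + δ * θ) * x ^ θ - (γ + δ) * θ * x - γ * (1 - θ)) / (θ * (1 - θ)) := by
      funext x; simp [limitFun, h0, h1]
    have h1' : 1 - θ ≠ 0 := sub_ne_zero.2 (Ne.symm h1)
    unfold limitDeriv
    rw [hf]
    refine (((((Real.hasDerivAt_rpow_const (p := θ) (Or.inl hx')).const_mul (γ + δ * θ)).sub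
      ((hasDerivAt_id x).const_mul ((γ + δ) * θ))).sub_const (γ * (1 - θ))).div_const
      (θ * (1 - θ))).congr_deriv ?_
    rw [Real.rpow_sub_one hx']
    field_simp
    ring

theorem hasDerivAt_limitDeriv (δ γ θ : ℝ) {x : ℝ} (hx : 0 < x) :
    HasDerivAt (limitDeriv δ γ θ) (-((γ + δ * θ) * x ^ (θ - 2))) x := by
  have hx' := hx.ne'
  refine (((((hasDerivAt_limitFun δ γ θ hx).const_mul θ).add_const γ).div
    (hasDerivAt_id x) hx').sub_const (γ + δ)).congr_deriv ?_
  have h2 : x ^ (θ - 2) = x ^ θ / x ^ 2 := by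
    rw [Real.rpow_sub hx]
    norm_num
  rw [h2, mul_div_assoc', ← limitFun_rpow δ γ θ x]
  simp only [limitDeriv, id]
  field_simp
  ring

theorem limitFun_one (δ γ θ : ℝ) : limitFun δ γ θ 1 = 0 := by
  unfold limitFun
  split_ifs
  · simp
  · simp
  · rw [Real.one_rpow]
    ring

theorem limitDeriv_one (δ γ θ : ℝ) : limitDeriv δ γ θ 1 = -δ := by
  rw [limitDeriv, limitFun_one]
  ring

theorem exists_sub_eq_mul {f f' : ℝ → ℝ} (hf : ∀ x, 0 < x → HasDerivAt f (f' x) x) {a b : ℝ}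
    (ha : 0 < a) (hab : a < b) : ∃ c ∈ Ioo a b, f b - f a = f' c * (b - a) := by
  obtain ⟨c, hc, h⟩ := exists_hasDerivAt_eq_slope f f' hab
    (fun x hx => (hf x (ha.trans_le hx.1)).continuousAt.continuousWithinAt)
    (fun x hx => hf x (ha.trans hx.1))
  refine ⟨c, hc, ?_⟩
  rw [h, div_mul_cancel₀ _ (sub_pos.2 hab).ne']

theorem limitDeriv_lt (hγ : 0 < γ) (hδ₀ : 0 < δ) (hθ₀ : 0 ≤ θ) {a b : ℝ} (ha : 0 < a)
    (hab : a < b) : limitDeriv δ γ θ b < limitDeriv δ γ θ a := by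
  obtain ⟨c, hc, h⟩ := exists_sub_eq_mul (fun x hx => hasDerivAt_limitDeriv δ γ θ hx) ha hab
  have hc0 : 0 < c := ha.trans hc.1
  have h1 : 0 < (γ + δ * θ) * c ^ (θ - 2) := by positivity
  nlinarith [mul_pos h1 (sub_pos.2 hab)]

theorem limitDeriv_le (hγ : 0 < γ) (hδ₀ : 0 < δ) (hθ₀ : 0 ≤ θ) {a b : ℝ} (ha : 0 < a)
    (hab : a ≤ b) : limitDeriv δ γ θ b ≤ limitDeriv δ γ θ a := by
  rcases hab.eq_or_lt with rfl | hab
  · exact le_rfl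
  · exact (limitDeriv_lt hγ hδ₀ hθ₀ ha hab).le

theorem limitDeriv_sub_le (hγ : 0 < γ) (hδ₀ : 0 < δ) (hθ₀ : 0 ≤ θ) (hθ₁ : θ ≤ 1) {a x y : ℝ}
    (ha : 0 < a) (hax : a ≤ x) (hxy : x ≤ y) :
    limitDeriv δ γ θ x - limitDeriv δ γ θ y ≤ (γ + δ * θ) * a ^ (θ - 2) * (y - x) := by
  rcases hxy.eq_or_lt with rfl | hxy
  · simp
  obtain ⟨c, hc, h⟩ := exists_sub_eq_mul (fun x hx => hasDerivAt_limitDeriv δ γ θ hx)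
    (ha.trans_le hax) hxy
  have h1 : c ^ (θ - 2) ≤ a ^ (θ - 2) :=
    Real.rpow_le_rpow_of_nonpos ha (hax.trans hc.1.le) (by linarith)
  have h2 : (γ + δ * θ) * c ^ (θ - 2) ≤ (γ + δ * θ) * a ^ (θ - 2) :=
    mul_le_mul_of_nonneg_left h1 (by positivity)
  nlinarith [mul_le_mul_of_nonneg_right h2 (sub_pos.2 hxy).le]

/-- If f ≥ 0 on (0,1), the differential equation gives f' ≥ γ/x - (γ+δ), so f - γ log x + (γ+δ)x
increases. Comparing e with 1, where γ log e = -(γ+δ), yields f(e) ≤ -(γ+δ)e < 0. -/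
theorem exists_limitFun_neg (hγ : 0 < γ) (hδ₀ : 0 < δ) (hθ₀ : 0 ≤ θ) :
    ∃ x ∈ Ioo (0 : ℝ) 1, limitFun δ γ θ x < 0 := by
  by_contra! hcon
  have hlt : Real.exp (-((γ + δ) / γ)) < 1 := Real.exp_lt_one_iff.2 (by
    rw [neg_lt_zero]; positivity)
  have hpos := Real.exp_pos (-((γ + δ) / γ))
  set e := Real.exp (-((γ + δ) / γ)) with he
  obtain ⟨c, hc, h⟩ := exists_sub_eq_mul
    (fun x hx => ((hasDerivAt_limitFun δ γ θ hx).sub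
      ((Real.hasDerivAt_log hx.ne').const_mul γ)).add ((hasDerivAt_id x).const_mul (γ + δ)))
    hpos hlt
  simp only [Pi.add_apply, Pi.sub_apply, id, limitFun_one, Real.log_one] at h
  have hc0 : 0 < c := hpos.trans hc.1
  have h1 : 0 ≤ limitDeriv δ γ θ c - γ * c⁻¹ + (γ + δ) * 1 := by
    have h2 : limitDeriv δ γ θ c - γ * c⁻¹ + (γ + δ) * 1 = θ * limitFun δ γ θ c / c := by
      rw [limitDeriv]; field_simp; ring
    rw [h2]
    have := hcon c ⟨hc0, hc.2⟩
    positivity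
  have h3 := mul_nonneg h1 (sub_pos.2 hlt).le
  rw [← h, he, Real.log_exp, ← he] at h3
  have h4 : γ * -((γ + δ) / γ) = -(γ + δ) := by field_simp
  have h5 := hcon e ⟨hpos, hlt⟩
  have h6 : 0 < (γ + δ) * e := by positivity
  linarith

theorem exists_limitFun_pos (hδ₀ : 0 < δ) {b : ℝ} (hb : b < 1) (hb0 : 0 < b) :
    ∃ x ∈ Ioo b 1, 0 < limitFun δ γ θ x := by
  have hcont := (hasDerivAt_limitDeriv δ γ θ one_pos).continuousAt
  have hev : ∀ᶠ x in 𝓝 (1 : ℝ), limitDeriv δ γ θ x < 0 :=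
    hcont.eventually_lt continuousAt_const (by rw [limitDeriv_one]; linarith)
  obtain ⟨l, hl, hI⟩ := exists_Ioc_subset_of_mem_nhds hev ⟨b, hb⟩
  obtain ⟨x, hx1, hx2⟩ := exists_between (max_lt hl hb)
  have hbx : b < x := (le_max_right _ _).trans_lt hx1
  refine ⟨x, ⟨hbx, hx2⟩, ?_⟩
  obtain ⟨c, hc, h⟩ := exists_sub_eq_mul (fun x hx => hasDerivAt_limitFun δ γ θ hx)
    (hb0.trans hbx) hx2
  rw [limitFun_one] at h
  have h1 : limitDeriv δ γ θ c < 0 :=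
    hI ⟨((le_max_left _ _).trans_lt hx1).trans hc.1, hc.2.le⟩
  nlinarith

theorem existsUnique_root (hγ : 0 < γ) (hδ₀ : 0 < δ) (hθ₀ : 0 ≤ θ) :
    ∃! x : ℝ, x ∈ Ioo (0 : ℝ) 1 ∧ limitFun δ γ θ x = 0 := by
  obtain ⟨a, ha, hfa⟩ := exists_limitFun_neg (θ := θ) hγ hδ₀ hθ₀
  obtain ⟨b, hb, hfb⟩ := exists_limitFun_pos (γ := γ) (θ := θ) hδ₀ ha.2 ha.1
  obtain ⟨x, hx, hfx⟩ := intermediate_value_Ioo hb.1.le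
    (fun x hx => (hasDerivAt_limitFun δ γ θ (ha.1.trans_le hx.1)).continuousAt.continuousWithinAt)
    ⟨hfa, hfb⟩
  -- Together with the zero at 1, two roots would give two critical points of a strictly concave
  -- function.
  have key : ∀ x y : ℝ, 0 < x → x < y → y < 1 → limitFun δ γ θ x = 0 → limitFun δ γ θ y = 0 →
      False := by
    intro x y hx hxy hy hfx hfy
    obtain ⟨c, hc, h1⟩ := exists_sub_eq_mul (fun x hx => hasDerivAt_limitFun δ γ θ hx) hx hxy
    obtain ⟨d, hd, h2⟩ := exists_sub_eq_mul (fun x hx => hasDerivAt_limitFun δ γ θ hx)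
      (hx.trans hxy) hy
    have h3 := limitDeriv_lt (θ := θ) hγ hδ₀ hθ₀ (hx.trans hc.1) (hc.2.trans hd.1)
    rw [hfx, hfy, sub_zero, zero_eq_mul, or_iff_left (sub_pos.2 hxy).ne'] at h1
    rw [limitFun_one, hfy, sub_zero, zero_eq_mul, or_iff_left (sub_pos.2 hy).ne'] at h2
    linarith
  refine ⟨x, ⟨⟨ha.1.trans hx.1, hx.2.trans hb.2⟩, hfx⟩, ?_⟩
  rintro y ⟨hy, hfy⟩
  rcases lt_trichotomy y x with h | h | h
  · exact (key y x hy.1 h (hx.2.trans hb.2) hfy hfx).elim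
  · exact h
  · exact (key x y (ha.1.trans hx.1) h hy.2 hfx hfy).elim

variable {r : ℝ}

theorem limitDeriv_pos (hγ : 0 < γ) (hδ₀ : 0 < δ) (hθ₀ : 0 ≤ θ) (hr : r ∈ Ioo (0 : ℝ) 1)
    (hfr : limitFun δ γ θ r = 0) {x : ℝ} (hx : 0 < x) (hxr : x ≤ r) : 0 < limitDeriv δ γ θ x := by
  obtain ⟨c, hc, h⟩ := exists_sub_eq_mul (fun x hx => hasDerivAt_limitFun δ γ θ hx) hr.1 hr.2
  rw [limitFun_one, hfr, sub_zero, zero_eq_mul, or_iff_left (sub_pos.2 hr.2).ne'] at h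
  rw [← h]
  exact limitDeriv_lt hγ hδ₀ hθ₀ hx (hxr.trans_lt hc.1)

theorem limitFun_neg (hγ : 0 < γ) (hδ₀ : 0 < δ) (hθ₀ : 0 ≤ θ) (hr : r ∈ Ioo (0 : ℝ) 1)
    (hfr : limitFun δ γ θ r = 0) {x : ℝ} (hx : 0 < x) (hxr : x < r) : limitFun δ γ θ x < 0 := by
  obtain ⟨c, hc, h⟩ := exists_sub_eq_mul (fun x hx => hasDerivAt_limitFun δ γ θ hx) hx hxr
  have h1 := limitDeriv_pos hγ hδ₀ hθ₀ hr hfr (hx.trans hc.1) hc.2.le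
  nlinarith [mul_pos h1 (sub_pos.2 hxr)]

theorem limitFun_pos (hγ : 0 < γ) (hδ₀ : 0 < δ) (hθ₀ : 0 ≤ θ) (hr : r ∈ Ioo (0 : ℝ) 1)
    (hfr : limitFun δ γ θ r = 0) {x : ℝ} (hrx : r < x) (hx : x < 1) : 0 < limitFun δ γ θ x := by
  obtain ⟨c, hc, h1⟩ := exists_sub_eq_mul (fun x hx => hasDerivAt_limitFun δ γ θ hx) hr.1 hrx
  obtain ⟨d, hd, h2⟩ := exists_sub_eq_mul (fun x hx => hasDerivAt_limitFun δ γ θ hx)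
    (hr.1.trans hrx) hx
  have h3 := limitDeriv_lt (θ := θ) hγ hδ₀ hθ₀ (hr.1.trans hc.1) (hc.2.trans hd.1)
  rw [hfr, sub_zero] at h1
  rw [limitFun_one] at h2
  by_contra! hneg
  have h4 : limitDeriv δ γ θ c ≤ 0 := by
    by_contra! h
    nlinarith [mul_pos h (sub_pos.2 hrx)]
  have h5 : 0 ≤ limitDeriv δ γ θ d := by
    by_contra! h
    nlinarith [mul_pos (neg_pos.2 h) (sub_pos.2 hx)]
  linarith

/-- `limitFun` on `[a, ∞)`, continued by its tangent at `a`. -/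
noncomputable def profile (δ γ θ a x : ℝ) : ℝ :=
  limitFun δ γ θ (max x a) + limitDeriv δ γ θ a * min (x - a) 0

variable {a : ℝ}

theorem profile_of_le (δ γ θ : ℝ) {x : ℝ} (h : a ≤ x) :
    profile δ γ θ a x = limitFun δ γ θ x := by
  rw [profile, max_eq_left h, min_eq_right (sub_nonneg.2 h), mul_zero, add_zero]

theorem profile_of_ge (δ γ θ : ℝ) {x : ℝ} (h : x ≤ a) :
    profile δ γ θ a x = limitFun δ γ θ a + limitDeriv δ γ θ a * (x - a) := by
  rw [profile, max_eq_right h, min_eq_left (sub_nonpos.2 h)]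

/-- A mean value formula across the gluing point: `max y a - max x a` is the length of the part of
[x,y] above `a`, and on the rest the slope is that of the tangent. -/
theorem exists_profile_sub_eq (δ γ θ : ℝ) (ha : 0 < a) {x y : ℝ} (hxy : x ≤ y) :
    ∃ c ∈ Icc (max x a) (max y a),
      profile δ γ θ a y - profile δ γ θ a x = limitDeriv δ γ θ c * (max y a - max x a) +
        limitDeriv δ γ θ a * ((y - x) - (max y a - max x a)) := by
  have hmin : ∀ z : ℝ, min (z - a) 0 = z - max z a := by
    intro z
    rcases le_total z a with h | h
    · rw [max_eq_right h, min_eq_left (sub_nonpos.2 h)]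
    · rw [max_eq_left h, min_eq_right (sub_nonneg.2 h), sub_self]
  simp only [profile, hmin]
  have hm : max x a ≤ max y a := max_le_max_right a hxy
  rcases hm.eq_or_lt with h | h
  · exact ⟨max x a, ⟨le_rfl, hm⟩, by rw [h]; ring⟩
  · obtain ⟨c, hc, h1⟩ := exists_sub_eq_mul (fun x hx => hasDerivAt_limitFun δ γ θ hx)
      (ha.trans_le (le_max_right x a)) h
    exact ⟨c, ⟨hc.1.le, hc.2.le⟩, by linear_combination h1⟩

theorem max_sub_max_mem (a : ℝ) {x y : ℝ} (hxy : x ≤ y) :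
    0 ≤ max y a - max x a ∧ max y a - max x a ≤ y - x := by
  constructor
  · linarith [max_le_max_right a hxy]
  · have : max y a ≤ max x a + (y - x) :=
      max_le (by linarith [le_max_left x a]) (by linarith [le_max_right x a])
    linarith

theorem abs_profile_sub_le (hγ : 0 < γ) (hδ₀ : 0 < δ) (hθ₀ : 0 ≤ θ) (ha : 0 < a) {b : ℝ}
    (hab : a ≤ b) {x y : ℝ} (hxy : x ≤ y) (hyb : y ≤ b) :
    |profile δ γ θ a y - profile δ γ θ a x| ≤
      (|limitDeriv δ γ θ b| + |limitDeriv δ γ θ a|) * (y - x) := by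
  obtain ⟨c, hc, h⟩ := exists_profile_sub_eq δ γ θ ha hxy
  obtain ⟨h1, h2⟩ := max_sub_max_mem a hxy
  have hac : a ≤ c := (le_max_right x a).trans hc.1
  have h3 := limitDeriv_le (θ := θ) hγ hδ₀ hθ₀ ha hac
  have h4 := limitDeriv_le (θ := θ) hγ hδ₀ hθ₀ (ha.trans_le hac) (hc.2.trans (max_le hyb hab))
  have h5 : |limitDeriv δ γ θ c| ≤ |limitDeriv δ γ θ b| + |limitDeriv δ γ θ a| := by
    rw [abs_le]
    constructor
    · linarith [neg_abs_le (limitDeriv δ γ θ b), abs_nonneg (limitDeriv δ γ θ a)]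
    · linarith [le_abs_self (limitDeriv δ γ θ a), abs_nonneg (limitDeriv δ γ θ b)]
  have h6 : |limitDeriv δ γ θ a| ≤ |limitDeriv δ γ θ b| + |limitDeriv δ γ θ a| := by
    linarith [abs_nonneg (limitDeriv δ γ θ b)]
  rw [h]
  refine (abs_add_le _ _).trans ?_
  rw [abs_mul, abs_mul, abs_of_nonneg h1, abs_of_nonneg (sub_nonneg.2 h2)]
  nlinarith [mul_le_mul_of_nonneg_right h5 h1, mul_le_mul_of_nonneg_right h6 (sub_nonneg.2 h2)]

/-- First-order Taylor estimate with a uniform quadratic remainder; |f''| is largest at `a` on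
[a,∞), and below `a` the slope is constant. -/
theorem abs_profile_sub_sub_le (hγ : 0 < γ) (hδ₀ : 0 < δ) (hθ₀ : 0 ≤ θ) (hθ₁ : θ ≤ 1)
    (ha : 0 < a) {x y : ℝ} (hxy : x ≤ y) :
    |profile δ γ θ a y - profile δ γ θ a x - (y - x) * limitDeriv δ γ θ (max y a)| ≤
      (γ + δ * θ) * a ^ (θ - 2) * (y - x) ^ 2 := by
  obtain ⟨c, hc, h⟩ := exists_profile_sub_eq δ γ θ ha hxy
  obtain ⟨h1, h2⟩ := max_sub_max_mem a hxy
  have hac : a ≤ c := (le_max_right x a).trans hc.1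
  have hC : 0 ≤ (γ + δ * θ) * a ^ (θ - 2) := by positivity
  set C := (γ + δ * θ) * a ^ (θ - 2)
  have hb : ∀ d, max x a ≤ d → d ≤ max y a →
      0 ≤ limitDeriv δ γ θ d - limitDeriv δ γ θ (max y a) ∧
      limitDeriv δ γ θ d - limitDeriv δ γ θ (max y a) ≤ C * (y - x) := by
    intro d hd1 hd2
    have had := (le_max_right x a).trans hd1
    refine ⟨sub_nonneg.2 (limitDeriv_le hγ hδ₀ hθ₀ (ha.trans_le had) hd2), ?_⟩
    refine (limitDeriv_sub_le hγ hδ₀ hθ₀ hθ₁ ha had hd2).trans ?_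
    exact mul_le_mul_of_nonneg_left (by linarith) hC
  obtain ⟨h3, h4⟩ := hb c hc.1 hc.2
  have h5 : 0 ≤ (limitDeriv δ γ θ a - limitDeriv δ γ θ (max y a)) *
      ((y - x) - (max y a - max x a)) ∧ (limitDeriv δ γ θ a - limitDeriv δ γ θ (max y a)) *
      ((y - x) - (max y a - max x a)) ≤ C * (y - x) * ((y - x) - (max y a - max x a)) := by
    rcases le_total a x with hax | hax
    · rw [max_eq_left hax, max_eq_left (hax.trans hxy)]
      simp
    · obtain ⟨h6, h7⟩ := hb a (by rw [max_eq_right hax]) (le_max_right _ _)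
      exact ⟨mul_nonneg h6 (sub_nonneg.2 h2), mul_le_mul_of_nonneg_right h7 (sub_nonneg.2 h2)⟩
  have h8 : profile δ γ θ a y - profile δ γ θ a x - (y - x) * limitDeriv δ γ θ (max y a) =
      (limitDeriv δ γ θ c - limitDeriv δ γ θ (max y a)) * (max y a - max x a) +
      (limitDeriv δ γ θ a - limitDeriv δ γ θ (max y a)) *
      ((y - x) - (max y a - max x a)) := by
    rw [h]; ring
  rw [h8, abs_of_nonneg (add_nonneg (mul_nonneg h3 h1) h5.1)]
  nlinarith [mul_le_mul_of_nonneg_right h4 h1, h5.2]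

theorem profile_neg (hγ : 0 < γ) (hδ₀ : 0 < δ) (hθ₀ : 0 ≤ θ) (hr : r ∈ Ioo (0 : ℝ) 1)
    (hfr : limitFun δ γ θ r = 0) (ha : 0 < a) (har : a < r) {x : ℝ} (hx : x < r) :
    profile δ γ θ a x < 0 := by
  rcases le_total a x with h | h
  · rw [profile_of_le _ _ _ h]
    exact limitFun_neg hγ hδ₀ hθ₀ hr hfr (ha.trans_le h) hx
  · rw [profile_of_ge _ _ _ h]
    have h1 := limitFun_neg hγ hδ₀ hθ₀ hr hfr ha har
    have h2 := limitDeriv_pos hγ hδ₀ hθ₀ hr hfr ha har.le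
    nlinarith [mul_nonneg h2.le (sub_nonneg.2 h)]

/-- Away from `y = profile x`, the mean-field drift of `y - profile x` points to `0`. -/
theorem sub_profile_mul_nonpos (hγ : 0 < γ) (hδ₀ : 0 < δ) (hθ₀ : 0 ≤ θ) (hθ₁ : θ ≤ 1)
    (hr : r ∈ Ioo (0 : ℝ) 1) (hfr : limitFun δ γ θ r = 0) (ha : 0 < a) (har : a < r) {x z : ℝ}
    (hz : 0 ≤ z) :
    (z - profile δ γ θ a x) * (x * limitDeriv δ γ θ (max x a) - θ * profile δ γ θ a x +
      (γ + δ) * x - γ) ≤ 0 := by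
  rcases le_total a x with h | h
  · have hx := (ha.trans_le h).ne'
    rw [profile_of_le _ _ _ h, max_eq_left h]
    -- Above `a` the bracket vanishes by the differential equation. Below `a` only signs matter: z ≥
    -- 0 > profile, and the bracket is (x-a)((1-θ)f'(a) + γ + δ).
    refine le_of_eq (mul_eq_zero_of_right _ ?_)
    rw [limitDeriv]
    field_simp
    ring
  · have h1 := profile_neg hγ hδ₀ hθ₀ hr hfr ha har (h.trans_lt har)
    refine mul_nonpos_of_nonneg_of_nonpos (by linarith) ?_
    rw [profile_of_ge _ _ _ h, max_eq_right h]
    have h2 := limitDeriv_pos hγ hδ₀ hθ₀ hr hfr ha har.le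
    have h3 : a * limitDeriv δ γ θ a = θ * limitFun δ γ θ a + γ - (γ + δ) * a := by
      rw [limitDeriv]
      field_simp
    nlinarith [mul_nonneg (mul_nonneg h2.le (sub_nonneg.2 h)) (sub_nonneg.2 hθ₁),
      mul_nonneg (add_pos hγ hδ₀).le (sub_nonneg.2 h)]

/-- Compactness: on [0,1] the profile vanishes only at `r` and 1, and neighbourhoods of both are
removed. -/
theorem exists_le_abs_profile (hγ : 0 < γ) (hδ₀ : 0 < δ) (hθ₀ : 0 ≤ θ)
    (hr : r ∈ Ioo (0 : ℝ) 1) (hfr : limitFun δ γ θ r = 0) (ha : 0 < a) (har : a < r) {ε κ : ℝ}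
    (hε : 0 < ε) (hκ : 0 < κ) :
    ∃ η > 0, ∀ x, 0 ≤ x → x ≤ 1 - κ → ε ≤ |x - r| → η ≤ |profile δ γ θ a x| := by
  set K : Set ℝ := Icc 0 (1 - κ) ∩ {x | ε ≤ |x - r|} with hKdef
  have hK : IsCompact K :=
    isCompact_Icc.inter_right (isClosed_le continuous_const (by fun_prop))
  have hcont : ContinuousOn (fun x => |profile δ γ θ a x|) K := by
    intro x _
    have hm : 0 < max x a := ha.trans_le (le_max_right _ _)
    have h1 : ContinuousAt (fun x => limitFun δ γ θ (max x a)) x :=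
      ContinuousAt.comp (f := fun x => max x a) (hasDerivAt_limitFun δ γ θ hm).continuousAt
        (by fun_prop)
    unfold profile
    exact ((h1.add (by fun_prop)).abs).continuousWithinAt
  rcases K.eq_empty_or_nonempty with hem | hne
  · refine ⟨1, one_pos, fun x h0 h1 h2 => ?_⟩
    have : x ∈ K := ⟨⟨h0, h1⟩, h2⟩
    rw [hem] at this
    exact this.elim
  · obtain ⟨z, hz, hmin⟩ := hK.exists_isMinOn hne hcont
    refine ⟨|profile δ γ θ a z|, ?_, fun x h0 h1 h2 => hmin ⟨⟨h0, h1⟩, h2⟩⟩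
    rw [gt_iff_lt, abs_pos]
    have hzr : z ≠ r := by
      rintro rfl
      have := hz.2
      simp only [Set.mem_ofPred_eq, sub_self, abs_zero] at this
      linarith
    rcases hzr.lt_or_gt with h | h
    · exact (profile_neg hγ hδ₀ hθ₀ hr hfr ha har h).ne
    · rw [profile_of_le _ _ _ (har.le.trans h.le)]
      exact (limitFun_pos hγ hδ₀ hθ₀ hr hfr h (by linarith [hz.1.2])).ne'

end LimitFun

end Rumour

namespace Rumour

/-! ### The three Lyapunov functions -/

section Lyapunov

variable {γ θ₁ θ₂ δ : ℝ}

theorem drift_add_const_mul (γ θ₁ θ₂ δ N : ℝ) (G H : ℝ → ℝ → ℝ → ℝ) (k x u y : ℝ) :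
    drift γ θ₁ θ₂ δ N (fun x u y => G x u y + k * H x u y) x u y =
      drift γ θ₁ θ₂ δ N G x u y + k * drift γ θ₁ θ₂ δ N H x u y := by
  simp only [drift]
  ring

/-- The number of uninterested individuals, centred and squared, is compensated by `x`. -/
theorem drift_uninterested (γ θ₁ θ₂ δ N x u y : ℝ) :
    drift γ θ₁ θ₂ δ N (fun x u _ => (u - (1 - δ) * (N - x)) ^ 2 + δ * (1 - δ) * x) x u y = 0 := by
  simp only [drift]
  ring

theorem exists_drift_sq_profile_le (hγ : 0 < γ) (hθ₁ : 0 ≤ θ₁) (hθ₂ : 0 ≤ θ₂) (hδ₀ : 0 < δ)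
    (hδ₁ : δ ≤ 1) (hθ₀ : 0 ≤ θ₁ + θ₂ - γ) (hθ_le : θ₁ + θ₂ - γ ≤ 1) {r a : ℝ}
    (hr : r ∈ Ioo (0 : ℝ) 1) (hfr : limitFun δ γ (θ₁ + θ₂ - γ) r = 0) (ha : 0 < a) (har : a < r) :
    ∃ K : ℝ, 0 ≤ K ∧ ∀ N x u y : ℝ, 0 < N → 0 ≤ x → 1 ≤ y → x + y ≤ N + 1 →
      drift γ θ₁ θ₂ δ N
        (fun x _ y => (y - 1 - N * profile δ γ (θ₁ + θ₂ - γ) a (x / N)) ^ 2) x u y ≤ K * N := by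
  set θ := θ₁ + θ₂ - γ with hθ
  set L := |limitDeriv δ γ θ 1| + |limitDeriv δ γ θ a| with hL
  set C := (γ + δ * θ) * a ^ (θ - 2) with hC
  have hL0 : 0 ≤ L := by positivity
  have hC0 : 0 ≤ C := by positivity
  have ha1 : a ≤ 1 := (har.trans hr.2).le
  -- The first term is the cost of replacing the increment `q` by the derivative `D`; the others
  -- bound the squared jumps.
  refine ⟨2 * (1 + L) * C + (1 + L) ^ 2 + 2 * θ₁ + θ₂ + γ, by positivity, ?_⟩
  intro N x u y hN hx hy hxy
  set P := profile δ γ θ a with hP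
  obtain ⟨q, hq⟩ : ∃ q, q = N * (P (x / N) - P ((x - 1) / N)) := ⟨_, rfl⟩
  obtain ⟨D, hD⟩ : ∃ D, D = limitDeriv δ γ θ (max (x / N) a) := ⟨_, rfl⟩
  obtain ⟨ξ, hξ⟩ : ∃ ξ, ξ = x / N := ⟨_, rfl⟩
  obtain ⟨z, hz⟩ : ∃ z, z = (y - 1) / N := ⟨_, rfl⟩
  have hxξ : x = N * ξ := by rw [hξ]; field_simp
  have hyz : y - 1 = N * z := by rw [hz]; field_simp
  have hξ0 : 0 ≤ ξ := by rw [hξ]; positivity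
  have hz0 : 0 ≤ z := by rw [hz]; exact div_nonneg (by linarith) hN.le
  have hsum : ξ + z ≤ 1 := by
    have : N * (ξ + z) ≤ N * 1 := by linarith
    exact le_of_mul_le_mul_left this hN
  have hdiff : x / N - (x - 1) / N = 1 / N := by ring
  have hle : (x - 1) / N ≤ x / N := by
    have : 0 ≤ 1 / N := by positivity
    linarith
  have hqL : |q| ≤ L := by
    have h1 := abs_profile_sub_le (θ := θ) hγ hδ₀ hθ₀ ha ha1 hle (by rw [← hξ]; linarith)
    rw [hdiff, ← hL, ← hP] at h1
    rw [hq, abs_mul, abs_of_pos hN]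
    calc N * |P (x / N) - P ((x - 1) / N)| ≤ N * (L * (1 / N)) :=
          mul_le_mul_of_nonneg_left h1 hN.le
      _ = L := by field_simp
  have hqD : |q - D| ≤ C / N := by
    have h1 := abs_profile_sub_sub_le (θ := θ) hγ hδ₀ hθ₀ hθ_le ha hle
    rw [hdiff, ← hD, ← hC, ← hP] at h1
    have h2 : q - D = N * (P (x / N) - P ((x - 1) / N) - 1 / N * D) := by
      rw [hq]; field_simp
    rw [h2, abs_mul, abs_of_pos hN]
    calc N * |P (x / N) - P ((x - 1) / N) - 1 / N * D| ≤ N * (C * (1 / N) ^ 2) :=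
          mul_le_mul_of_nonneg_left h1 hN.le
      _ = C / N := by field_simp
  have hPξ : |P ξ| ≤ L := by
    have h1 := abs_profile_sub_le (θ := θ) hγ hδ₀ hθ₀ ha ha1 (x := ξ) (y := 1) (by linarith) le_rfl
    rw [profile_of_le δ γ θ ha1, limitFun_one, zero_sub, abs_neg] at h1
    exact h1.trans (mul_le_of_le_one_right hL0 (by linarith))
  have hzP : |z - P ξ| ≤ 1 + L := by
    refine (abs_sub _ _).trans (add_le_add ?_ hPξ)
    rw [abs_of_nonneg hz0]
    linarith
  have hR := sub_profile_mul_nonpos hγ hδ₀ hθ₀ hθ_le hr hfr ha har (x := ξ) hz0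
  rw [← hP] at hR
  have hDξ : limitDeriv δ γ θ (max ξ a) = D := by rw [hD, hξ]
  rw [hDξ] at hR
  have hx1 : N * P ((x - 1) / N) = N * P ξ - q := by rw [hq, hξ]; ring
  -- Centring at y - 1 rather than y makes the linear part of the drift exactly the mean-field one,
  -- with no error of order 1.
  have hmain : drift γ θ₁ θ₂ δ N (fun x _ y => (y - 1 - N * P (x / N)) ^ 2) x u y =
      2 * N ^ 2 * ((z - P ξ) * (ξ * D - θ * P ξ + (γ + δ) * ξ - γ) - θ * z * (z - P ξ)
        + θ * P ξ * (z - P ξ) + (z - P ξ) * ξ * (q - D))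
      + N * (δ * ξ * (1 + q) ^ 2 + (1 - δ) * ξ * q ^ 2 + 2 * θ₁ * z + θ₂ * z + γ * (1 - ξ - z)) := by
    simp only [drift]
    rw [hx1, ← hξ]
    have hy' : y = N * z + 1 := by linarith
    rw [hy', hxξ, hθ]
    ring
  have hprod : (z - P ξ) * ξ * (q - D) ≤ (1 + L) * (C / N) := by
    have h1 : |(z - P ξ) * ξ * (q - D)| ≤ (1 + L) * 1 * (C / N) := by
      rw [abs_mul, abs_mul, abs_of_nonneg hξ0]
      gcongr
      linarith
    rw [mul_one] at h1
    exact (le_abs_self _).trans h1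
  have hfirst : (z - P ξ) * (ξ * D - θ * P ξ + (γ + δ) * ξ - γ) - θ * z * (z - P ξ)
        + θ * P ξ * (z - P ξ) + (z - P ξ) * ξ * (q - D) ≤ (1 + L) * (C / N) := by
    have h1 := mul_nonneg hθ₀ (sq_nonneg (z - P ξ))
    have h2 : θ * (z - P ξ) ^ 2 = θ * z * (z - P ξ) - θ * P ξ * (z - P ξ) := by ring
    linarith
  have hξ1 : ξ ≤ 1 := by linarith
  have hz1 : z ≤ 1 := by linarith
  obtain ⟨hq1, hq2⟩ := abs_le.1 hqL
  have hsq1 : (1 + q) ^ 2 ≤ (1 + L) ^ 2 := sq_le_sq' (by linarith) (by linarith)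
  have hsq2 : q ^ 2 ≤ (1 + L) ^ 2 := sq_le_sq' (by linarith) (by linarith)
  have hδ' : 0 ≤ 1 - δ := by linarith
  have hup : δ * ξ * (1 + q) ^ 2 + (1 - δ) * ξ * q ^ 2 ≤ (1 + L) ^ 2 := by
    have h1 : δ * ξ * (1 + q) ^ 2 ≤ δ * ξ * (1 + L) ^ 2 :=
      mul_le_mul_of_nonneg_left hsq1 (by positivity)
    have h2 : (1 - δ) * ξ * q ^ 2 ≤ (1 - δ) * ξ * (1 + L) ^ 2 :=
      mul_le_mul_of_nonneg_left hsq2 (by positivity)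
    linarith [mul_le_mul_of_nonneg_right hξ1 (sq_nonneg (1 + L))]
  have hdown : 2 * θ₁ * z + θ₂ * z + γ * (1 - ξ - z) ≤ 2 * θ₁ + θ₂ + γ := by
    linarith [mul_le_mul_of_nonneg_left hz1 hθ₁, mul_le_mul_of_nonneg_left hz1 hθ₂,
      mul_nonneg hγ.le (add_nonneg hξ0 hz0)]
  rw [hmain]
  have h1 := mul_le_mul_of_nonneg_left hfirst (by positivity : 0 ≤ 2 * N ^ 2)
  have h2 : 2 * N ^ 2 * ((1 + L) * (C / N)) = 2 * (1 + L) * C * N := by field_simp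
  have h3 := mul_le_mul_of_nonneg_left (add_le_add hup hdown) hN.le
  rw [h2] at h1
  linarith

/-- The weight of the early extinction estimate: it is at least `1` on the absorbed states with
`x ≥ (1 - ε) N`, and small at the initial state. -/
noncomputable def earlyWeight (b m ε N x y : ℝ) : ℝ :=
  if x < (1 - ε) * N then 0 else if y = 0 then 1 else 2 ^ (-y) * (b * (N - x + m) / N)

/-- Near x = N, new spreaders appear at rate about δN and halve 2^(-y), while spreaders are lost at
rate at most κ(N-x). The linear factor, called ψ below, grows with N - x, so the gain also pays for
the jump of the weight to 1 at y = 0. Setting the weight to 0 for x < (1-ε)N only lowers the drift.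
-/
theorem exists_drift_earlyWeight_le (hγ : 0 < γ) (hθ₁ : 0 ≤ θ₁) (hθ₂ : 0 ≤ θ₂) (hδ₀ : 0 < δ)
    (hδ₁ : δ ≤ 1) :
    ∃ b m ε : ℝ, 0 < b ∧ 1 ≤ m ∧ 0 < ε ∧ ∀ N x u y : ℝ, 0 < N → 0 ≤ x → 1 ≤ y →
      x + y ≤ N + 1 → (∃ k : ℕ, y = k) →
      drift γ θ₁ θ₂ δ N (fun x _ y => earlyWeight b m ε N x y) x u y ≤ 0 := by
  obtain ⟨κ, hκ⟩ : ∃ κ, κ = θ₁ + θ₂ + γ := ⟨_, rfl⟩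
  have hκ0 : 0 < κ := by rw [hκ]; positivity
  obtain ⟨ε, hε⟩ : ∃ ε, ε = min (1 / 2) (δ / (64 * κ)) := ⟨_, rfl⟩
  have hε0 : 0 < ε := by rw [hε]; exact lt_min (by norm_num) (by positivity)
  have hε1 : ε ≤ 1 / 2 := by rw [hε]; exact min_le_left _ _
  have hε2 : 64 * κ * ε ≤ δ := by
    have : ε ≤ δ / (64 * κ) := by rw [hε]; exact min_le_right _ _
    rw [le_div_iff₀ (by positivity)] at this
    linarith
  -- `b` gives 64κ(N-x) ≤ δNψ, which absorbs extinction; `m` gives b/N ≤ δψ/4, so that the growth of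
  -- ψ costs at most half of the gain; ε gives 64κ(N-x) ≤ δN.
  refine ⟨64 * κ / δ, 4 / δ, ε, by positivity, ?_, hε0, ?_⟩
  · rw [le_div_iff₀ hδ₀]
    linarith
  intro N x u y hN hx hy hxy hk
  obtain ⟨b, hb⟩ : ∃ b, b = 64 * κ / δ := ⟨_, rfl⟩
  obtain ⟨m, hm⟩ : ∃ m, m = 4 / δ := ⟨_, rfl⟩
  have hb0 : 0 < b := by rw [hb]; positivity
  have hm0 : 0 < m := by rw [hm]; positivity
  rw [← hb, ← hm]
  have hy0 : y ≠ 0 := by linarith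
  have hn0 : 0 ≤ N - x := by linarith
  by_cases hxε : x < (1 - ε) * N
  · have hxε' : x - 1 < (1 - ε) * N := by linarith
    simp [drift, earlyWeight, hxε, hxε']
  have hnε : N - x ≤ ε * N := by linarith
  obtain ⟨p, hp⟩ : ∃ p : ℝ, p = 2 ^ (-y) := ⟨_, rfl⟩
  have hp0 : 0 < p := by rw [hp]; positivity
  obtain ⟨ψ, hψ⟩ : ∃ ψ, ψ = b * (N - x + m) / N := ⟨_, rfl⟩
  have hψ0 : 0 ≤ ψ := by rw [hψ]; positivity
  have hG : earlyWeight b m ε N x y = p * ψ := by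
    rw [earlyWeight, if_neg hxε, if_neg hy0, hp, hψ]
  have hstep : b * (N - (x - 1) + m) / N = ψ + b / N := by rw [hψ]; ring
  have hψ1 : 0 ≤ ψ + b / N := by positivity
  have hG1 : earlyWeight b m ε N (x - 1) (y + 1) ≤ p / 2 * (ψ + b / N) := by
    rw [earlyWeight, if_neg (by linarith : y + 1 ≠ 0), hstep, neg_add, Real.rpow_add two_pos, ← hp,
      Real.rpow_neg_one]
    split_ifs
    · positivity
    · exact le_of_eq (by ring)
  have hG2 : earlyWeight b m ε N (x - 1) y ≤ p * (ψ + b / N) := by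
    rw [earlyWeight, if_neg hy0, hstep, ← hp]
    split_ifs
    · positivity
    · exact le_rfl
  have hG3 : earlyWeight b m ε N x (y - 2) ≤ 4 * p * (1 + ψ) := by
    rw [earlyWeight, if_neg hxε, ← hψ, show -(y - 2) = -y + 2 by ring, Real.rpow_add two_pos, ← hp]
    split_ifs with h
    · have h1 : p * 4 = 1 := by
        rw [hp, show y = 2 by linarith, Real.rpow_neg two_pos.le]
        norm_num
      linarith [mul_nonneg hp0.le hψ0]
    · norm_num
      linarith
  have hG4 : earlyWeight b m ε N x (y - 1) ≤ 4 * p * (1 + ψ) := by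
    rw [earlyWeight, if_neg hxε, ← hψ, show -(y - 1) = -y + 1 by ring, Real.rpow_add two_pos, ← hp]
    split_ifs with h
    · have h1 : p * 2 = 1 := by
        rw [hp, show y = 1 by linarith, Real.rpow_neg two_pos.le]
        norm_num
      linarith [mul_nonneg hp0.le hψ0]
    · rw [Real.rpow_one]
      linarith [mul_nonneg hp0.le hψ0]
  have hδ' : 0 ≤ 1 - δ := by linarith
  have hy1 : 0 ≤ y - 1 := by linarith
  have hz1 : 0 ≤ N + 1 - x - y := by linarith
  have hG0 : 0 ≤ p * ψ := by positivity
  have hbN : b / N ≤ δ / 4 * ψ := by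
    have h1 : δ / 4 * ψ = b / N * (δ / 4 * (N - x) + 1) := by
      rw [hψ, hm]; field_simp
    rw [h1]
    exact le_mul_of_one_le_right (by positivity) (by linarith [mul_nonneg hδ₀.le hn0])
  simp only [drift, hG]
  have hup : δ * x * (earlyWeight b m ε N (x - 1) (y + 1) - p * ψ) +
      (1 - δ) * x * (earlyWeight b m ε N (x - 1) y - p * ψ) ≤ -(x * p * (δ / 4 * ψ)) := by
    have h1 := mul_le_mul_of_nonneg_left hG1 (by positivity : 0 ≤ δ * x)
    have h2 := mul_le_mul_of_nonneg_left hG2 (by positivity : 0 ≤ (1 - δ) * x)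
    have h3 := mul_le_mul_of_nonneg_left hbN (by positivity : 0 ≤ x * p)
    have h4 : 0 ≤ x * p * (δ / 2) * (b / N) := by positivity
    linarith
  have hdown : θ₁ * (y - 1) / 2 * (earlyWeight b m ε N x (y - 2) - p * ψ) +
      (θ₂ * (y - 1) + γ * (N + 1 - x - y)) * (earlyWeight b m ε N x (y - 1) - p * ψ) ≤
      κ * (N - x) * (4 * p * (1 + ψ)) := by
    have h1 := mul_le_mul_of_nonneg_left (sub_le_self _ hG0 |>.trans hG3)
      (by positivity : 0 ≤ θ₁ * (y - 1) / 2)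
    have h2 := mul_le_mul_of_nonneg_left (sub_le_self _ hG0 |>.trans hG4)
      (by positivity : 0 ≤ θ₂ * (y - 1) + γ * (N + 1 - x - y))
    have h3 : θ₁ * (y - 1) / 2 + (θ₂ * (y - 1) + γ * (N + 1 - x - y)) ≤ κ * (N - x) := by
      rw [hκ]
      linarith [mul_nonneg hθ₁ hy1, mul_nonneg hθ₁ hz1, mul_nonneg hθ₂ hz1, mul_nonneg hγ.le hy1]
    have h4 := mul_le_mul_of_nonneg_right h3 (by positivity : 0 ≤ 4 * p * (1 + ψ))
    linarith
  have hbal : 4 * κ * (N - x) * (1 + ψ) ≤ x * (δ / 4 * ψ) := by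
    have hψN : 64 * κ * (N - x) ≤ δ * (N * ψ) := by
      have h1 : δ * (N * ψ) = 64 * κ * (N - x) + 64 * κ * m := by
        rw [hψ, hb]; field_simp
      rw [h1]
      have : 0 ≤ 64 * κ * m := by positivity
      linarith
    have h2 : N / 2 ≤ x := by
      linarith [mul_le_mul_of_nonneg_right hε1 hN.le]
    have h3 := mul_le_mul_of_nonneg_right h2 (by positivity : 0 ≤ δ / 4 * ψ)
    have h4 : 64 * κ * (N - x) ≤ δ * N := by
      have h5 := mul_le_mul_of_nonneg_left hnε (by positivity : 0 ≤ 64 * κ)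
      have h6 := mul_le_mul_of_nonneg_right hε2 hN.le
      linarith
    have h7 := mul_le_mul_of_nonneg_right h4 hψ0
    linarith
  have hbal' := mul_le_mul_of_nonneg_left hbal hp0.le
  linarith

end Lyapunov

end Rumour

/-! ### Convergence in probability -/

namespace Rumour

theorem tendsto_zero_of_le_ofReal_div {f : ℕ → ℝ≥0∞} (A : ℝ)
    (h : ∀ᶠ N in atTop, f N ≤ ENNReal.ofReal (A / N)) : Tendsto f atTop (𝓝 0) :=
  tendsto_of_tendsto_of_tendsto_of_le_of_le' tendsto_const_nhds (tendsto_ofReal_div_natCast A)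
    (Eventually.of_forall fun _ => zero_le) h

theorem tendsto_measure_zero_of_subset_union {Ω : ℕ → Type*} [∀ N, MeasurableSpace (Ω N)]
    {μ : ∀ N, Measure (Ω N)} {s t u : ∀ N, Set (Ω N)}
    (ht : Tendsto (fun N => μ N (t N)) atTop (𝓝 0)) (hu : Tendsto (fun N => μ N (u N)) atTop (𝓝 0))
    (h : ∀ᶠ N in atTop, s N ⊆ t N ∪ u N) : Tendsto (fun N => μ N (s N)) atTop (𝓝 0) := by
  have htu := ht.add hu
  rw [add_zero] at htu
  refine tendsto_of_tendsto_of_tendsto_of_le_of_le' tendsto_const_nhds htu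
    (Eventually.of_forall fun _ => zero_le) ?_
  filter_upwards [h] with N hN
  exact (measure_mono hN).trans (measure_union_le _ _)

section Convergence

variable {lam γ θ₁ θ₂ δ : ℝ} {Ω : ℕ → Type*} [∀ N, MeasurableSpace (Ω N)]
  {μ : ∀ N, Measure (Ω N)} [∀ N, IsProbabilityMeasure (μ N)] {V : ∀ N, ℝ≥0 → Ω N → State N}

theorem tendsto_measure_uninterested (hlam : 0 < lam) (hγ : 0 < γ) (hθ₁ : 0 ≤ θ₁)
    (hθ₂ : 0 ≤ θ₂) (hδ₀ : 0 < δ) (hδ₁ : δ ≤ 1) (hθ₀ : 0 ≤ θ₁ + θ₂ - γ)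
    (hV : ∀ N, 1 ≤ N → IsRumourChain lam γ θ₁ θ₂ δ N (μ N) (V N)) {ε : ℝ} (hε : 0 < ε) :
    Tendsto (fun N => μ N {ω | ε ≤ |((finalState (V N) ω).u : ℝ) / N -
      (1 - δ) * (1 - ((finalState (V N) ω).x : ℝ) / N)|}) atTop (𝓝 0) := by
  refine tendsto_zero_of_le_ofReal_div (δ * (1 - δ) / ε ^ 2) ?_
  filter_upwards [eventually_ge_atTop 1] with N hN
  have hN' : (0 : ℝ) < N := by exact_mod_cast hN
  have hδ' : 0 ≤ 1 - δ := by linarith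
  have h := (hV N hN).measure_finalState_le hN hlam hγ hθ₁ hθ₂ hδ₀ hδ₁ hθ₀
    (G := fun x u _ => (u - (1 - δ) * (N - x)) ^ 2 + δ * (1 - δ) * x)
    (B := fun v => ε ≤ |(v.u : ℝ) / N - (1 - δ) * (1 - (v.x : ℝ) / N)|) (c := (ε * N) ^ 2)
    (fun v => by positivity) (fun x u y _ _ _ _ => (drift_uninterested _ _ _ _ _ _ _ _).le)
    (by positivity) ?_
  · refine h.trans (ENNReal.ofReal_le_ofReal (le_of_eq ?_))
    field_simp
    ring
  · intro v hv _
    have h1 : (v.u : ℝ) - (1 - δ) * (N - v.x) =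
        N * ((v.u : ℝ) / N - (1 - δ) * (1 - (v.x : ℝ) / N)) := by field_simp
    have h2 : (ε * N) ^ 2 ≤ ((v.u : ℝ) - (1 - δ) * (N - v.x)) ^ 2 := by
      rw [h1, mul_pow, mul_pow, mul_comm, ← sq_abs (_ - _)]
      gcongr
    have h3 : 0 ≤ δ * (1 - δ) * v.x := by positivity
    linarith

theorem tendsto_measure_profile (hlam : 0 < lam) (hγ : 0 < γ) (hθ₁ : 0 ≤ θ₁)
    (hθ₂ : 0 ≤ θ₂) (hδ₀ : 0 < δ) (hδ₁ : δ ≤ 1) (hθ₀ : 0 ≤ θ₁ + θ₂ - γ) (hθ_le : θ₁ + θ₂ - γ ≤ 1)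
    (hV : ∀ N, 1 ≤ N → IsRumourChain lam γ θ₁ θ₂ δ N (μ N) (V N)) {r a : ℝ}
    (hr : r ∈ Ioo (0 : ℝ) 1) (hfr : limitFun δ γ (θ₁ + θ₂ - γ) r = 0) (ha : 0 < a) (har : a < r)
    {η : ℝ} (hη : 0 < η) :
    Tendsto (fun N => μ N {ω | η ≤ |profile δ γ (θ₁ + θ₂ - γ) a
      (((finalState (V N) ω).x : ℝ) / N)|}) atTop (𝓝 0) := by
  obtain ⟨K, hK0, hK⟩ := exists_drift_sq_profile_le hγ hθ₁ hθ₂ hδ₀ hδ₁ hθ₀ hθ_le hr hfr ha har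
  have hc : 0 < min 1 γ := lt_min one_pos hγ
  -- The square vanishes initially, so the initial value is (K / min 1 γ)(2N+1) ≤ 3N(K / min 1 γ),
  -- divided by (ηN/2)². The condition ηN ≥ 2 absorbs the offset -1 left at y = 0.
  refine tendsto_zero_of_le_ofReal_div (12 * (K / min 1 γ) / η ^ 2) ?_
  filter_upwards [eventually_ge_atTop 1, eventually_ge_atTop ⌈2 / η⌉₊] with N hN hNη
  have hN1 : (1 : ℝ) ≤ N := by exact_mod_cast hN
  have hN' : (0 : ℝ) < N := by linarith
  have hηN : 2 ≤ η * N := by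
    have := Nat.ceil_le.1 hNη
    rwa [div_le_iff₀' hη] at this
  set P := profile δ γ (θ₁ + θ₂ - γ) a with hP
  have h := (hV N hN).measure_finalState_le hN hlam hγ hθ₁ hθ₂ hδ₀ hδ₁ hθ₀
    (G := fun x _ y => (y - 1 - N * P (x / N)) ^ 2 + K / min 1 γ * (2 * x + y))
    (B := fun v => η ≤ |P ((v.x : ℝ) / N)|) (c := (η * N / 2) ^ 2)
    (fun v => by positivity) ?_ (by positivity) ?_
  · refine h.trans (ENNReal.ofReal_le_ofReal ?_)
    have hP1 : P (N / N) = 0 := by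
      rw [div_self hN'.ne', hP, profile_of_le _ _ _ (har.trans hr.2).le, limitFun_one]
    rw [hP1]
    have h1 : (12 * (K / min 1 γ) / η ^ 2 / N : ℝ) =
        (K / min 1 γ * (3 * N)) / (η * N / 2) ^ 2 := by field_simp; ring
    rw [h1]
    gcongr
    have h2 : K / min 1 γ * (2 * N + 1) ≤ K / min 1 γ * (3 * N) :=
      mul_le_mul_of_nonneg_left (by linarith) (by positivity)
    linarith
  · intro x u y hx hy hxy _
    rw [drift_add_const_mul γ θ₁ θ₂ δ N (fun x _ y => (y - 1 - N * P (x / N)) ^ 2)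
      (fun x _ y => 2 * x + y)]
    have h1 := hK N x u y hN' hx hy hxy
    have h2 := drift_potential_le hδ₁ hθ₀ u hx (by linarith : x ≤ N) hy
    have h3 := mul_le_mul_of_nonneg_left h2 (by positivity : 0 ≤ K / min 1 γ)
    have h4 : K / min 1 γ * -(min 1 γ * N) = -(K * N) := by field_simp
    linarith
  · intro v hv hy
    simp only [hy, Nat.cast_zero]
    have h1 : η * N / 2 ≤ |0 - 1 - N * P ((v.x : ℝ) / N)| := by
      have h2 : |N * P ((v.x : ℝ) / N)| - |(-1 : ℝ)| ≤ |N * P ((v.x : ℝ) / N) - -1| :=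
        abs_sub_abs_le_abs_sub _ _
      rw [abs_mul, abs_of_pos hN', abs_neg, abs_one] at h2
      rw [← abs_neg, show -(0 - 1 - N * P ((v.x : ℝ) / N)) = N * P ((v.x : ℝ) / N) - -1 by ring]
      have h3 := mul_le_mul_of_nonneg_left hv hN'.le
      linarith
    have h5 : (η * N / 2) ^ 2 ≤ (0 - 1 - N * P ((v.x : ℝ) / N)) ^ 2 := by
      rw [← sq_abs (0 - 1 - _)]
      gcongr
    have h6 : 0 ≤ K / min 1 γ * (2 * v.x + 0) := by positivity
    linarith

theorem exists_tendsto_measure_early (hlam : 0 < lam) (hγ : 0 < γ) (hθ₁ : 0 ≤ θ₁)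
    (hθ₂ : 0 ≤ θ₂) (hδ₀ : 0 < δ) (hδ₁ : δ ≤ 1) (hθ₀ : 0 ≤ θ₁ + θ₂ - γ)
    (hV : ∀ N, 1 ≤ N → IsRumourChain lam γ θ₁ θ₂ δ N (μ N) (V N)) :
    ∃ ε > 0, Tendsto (fun N => μ N {ω | 1 - ε ≤ ((finalState (V N) ω).x : ℝ) / N})
      atTop (𝓝 0) := by
  obtain ⟨b, m, ε, hb, hm, hε, hdrift⟩ := exists_drift_earlyWeight_le hγ hθ₁ hθ₂ hδ₀ hδ₁
  refine ⟨ε, hε, tendsto_zero_of_le_ofReal_div (b * m / 2) ?_⟩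
  filter_upwards [eventually_ge_atTop 1] with N hN
  have hN' : (0 : ℝ) < N := by exact_mod_cast hN
  have h := (hV N hN).measure_finalState_le hN hlam hγ hθ₁ hθ₂ hδ₀ hδ₁ hθ₀
    (G := fun x _ y => earlyWeight b m ε N x y)
    (B := fun v => 1 - ε ≤ (v.x : ℝ) / N) (c := 1) ?_
    (fun x u y hx hy hxy hk => hdrift N x u y hN' hx hy hxy hk) one_pos ?_
  · refine h.trans (ENNReal.ofReal_le_ofReal (le_of_eq ?_))
    have h1 : ¬ (N : ℝ) < (1 - ε) * N := by nlinarith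
    rw [earlyWeight, if_neg h1, if_neg one_ne_zero, Real.rpow_neg_one]
    field_simp
    ring
  · intro v
    have hx : (v.x : ℝ) ≤ N + 1 := by
      have := v.total_le
      exact_mod_cast (by omega : v.x ≤ N + 1)
    have h1 : 0 ≤ (N : ℝ) - v.x + m := by linarith
    simp only [earlyWeight]
    split_ifs <;> positivity
  · intro v hv hy
    rw [le_div_iff₀ hN'] at hv
    simp [earlyWeight, not_lt.2 hv, hy]

theorem tendstoInProbability_x (hlam : 0 < lam) (hγ : 0 < γ) (hθ₁ : 0 ≤ θ₁)
    (hθ₂ : 0 ≤ θ₂) (hδ₀ : 0 < δ) (hδ₁ : δ ≤ 1) (hθ₀ : 0 ≤ θ₁ + θ₂ - γ) (hθ_le : θ₁ + θ₂ - γ ≤ 1)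
    (hV : ∀ N, 1 ≤ N → IsRumourChain lam γ θ₁ θ₂ δ N (μ N) (V N)) {r : ℝ}
    (hr : r ∈ Ioo (0 : ℝ) 1) (hfr : limitFun δ γ (θ₁ + θ₂ - γ) r = 0) :
    TendstoInProbability μ (fun N ω => ((finalState (V N) ω).x : ℝ) / N) r := by
  intro ε hε
  obtain ⟨κ, hκ, hearly⟩ := exists_tendsto_measure_early hlam hγ hθ₁ hθ₂ hδ₀ hδ₁ hθ₀ hV
  -- The tangent is glued at a = r/2; any point of (0,r) would do.
  obtain ⟨η, hη, hηle⟩ := exists_le_abs_profile hγ hδ₀ hθ₀ hr hfr (half_pos hr.1)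
    (half_lt_self hr.1) hε hκ
  refine tendsto_measure_zero_of_subset_union (tendsto_measure_profile hlam hγ hθ₁ hθ₂ hδ₀ hδ₁ hθ₀
    hθ_le hV hr hfr (half_pos hr.1) (half_lt_self hr.1) hη) hearly (Eventually.of_forall ?_)
  intro N ω hω
  rcases le_total ((finalState (V N) ω).x / N : ℝ) (1 - κ) with h | h
  · exact Or.inl (hηle _ (by positivity) h hω)
  · exact Or.inr h

theorem tendstoInProbability_u (hlam : 0 < lam) (hγ : 0 < γ) (hθ₁ : 0 ≤ θ₁)
    (hθ₂ : 0 ≤ θ₂) (hδ₀ : 0 < δ) (hδ₁ : δ ≤ 1) (hθ₀ : 0 ≤ θ₁ + θ₂ - γ) (hθ_le : θ₁ + θ₂ - γ ≤ 1)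
    (hV : ∀ N, 1 ≤ N → IsRumourChain lam γ θ₁ θ₂ δ N (μ N) (V N)) {r : ℝ}
    (hr : r ∈ Ioo (0 : ℝ) 1) (hfr : limitFun δ γ (θ₁ + θ₂ - γ) r = 0) :
    TendstoInProbability μ (fun N ω => ((finalState (V N) ω).u : ℝ) / N) ((1 - δ) * (1 - r)) := by
  intro ε hε
  refine tendsto_measure_zero_of_subset_union
    (tendsto_measure_uninterested hlam hγ hθ₁ hθ₂ hδ₀ hδ₁ hθ₀ hV (half_pos hε))
    (tendstoInProbability_x hlam hγ hθ₁ hθ₂ hδ₀ hδ₁ hθ₀ hθ_le hV hr hfr (ε / 2) (half_pos hε))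
    (Eventually.of_forall ?_)
  intro N ω hω
  by_contra hcon
  simp only [mem_union, Set.mem_ofPred_eq, not_or, not_le] at hcon hω
  obtain ⟨h1, h2⟩ := hcon
  have h3 : |(1 - δ) * (r - ((finalState (V N) ω).x : ℝ) / N)| ≤
      |((finalState (V N) ω).x : ℝ) / N - r| := by
    rw [abs_mul, abs_sub_comm r]
    exact mul_le_of_le_one_left (abs_nonneg _) (abs_le.2 ⟨by linarith, by linarith⟩)
  have h4 := abs_add_le (((finalState (V N) ω).u : ℝ) / N -
      (1 - δ) * (1 - ((finalState (V N) ω).x : ℝ) / N))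
    ((1 - δ) * (r - ((finalState (V N) ω).x : ℝ) / N))
  rw [show ((finalState (V N) ω).u : ℝ) / N - (1 - δ) * (1 - ((finalState (V N) ω).x : ℝ) / N) +
    (1 - δ) * (r - ((finalState (V N) ω).x : ℝ) / N) =
    ((finalState (V N) ω).u : ℝ) / N - (1 - δ) * (1 - r) by ring] at h4
  linarith

end Convergence

end Rumour

theorem theorem1 (lam γ θ₁ θ₂ δ : ℝ) (hlam : 0 < lam) (hγ : 0 < γ) (hθ₁ : 0 ≤ θ₁) (hθ₂ : 0 ≤ θ₂)
    (hδ₀ : 0 < δ) (hδ₁ : δ ≤ 1) (hθ₀ : 0 ≤ θ₁ + θ₂ - γ) (hθ_le : θ₁ + θ₂ - γ ≤ 1)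
    {Ω : ℕ → Type*} [∀ N, MeasurableSpace (Ω N)] (μ : ∀ N, Measure (Ω N))
    [∀ N, IsProbabilityMeasure (μ N)] (V : ∀ N, ℝ≥0 → Ω N → Rumour.State N)
    (hV : ∀ N, 1 ≤ N → Rumour.IsRumourChain lam γ θ₁ θ₂ δ N (μ N) (V N)) :
    (∃! x : ℝ, x ∈ Set.Ioo (0 : ℝ) 1 ∧ Rumour.limitFun δ γ (θ₁ + θ₂ - γ) x = 0) ∧
    (∀ N, 1 ≤ N → ∀ᵐ ω ∂(μ N), ∃ t : ℝ≥0, (V N t ω).y = 0) ∧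
    ∀ x_inf : ℝ, x_inf ∈ Set.Ioo (0 : ℝ) 1 →
      Rumour.limitFun δ γ (θ₁ + θ₂ - γ) x_inf = 0 →
      Rumour.TendstoInProbability μ
        (fun N ω => ((Rumour.finalState (V N) ω).x : ℝ) / N) x_inf ∧
      Rumour.TendstoInProbability μ
        (fun N ω => ((Rumour.finalState (V N) ω).u : ℝ) / N) ((1 - δ) * (1 - x_inf)) := by
  refine ⟨Rumour.existsUnique_root hγ hδ₀ hθ₀, fun N hN =>
    (hV N hN).ae_exists_absorbed hN hlam hγ hθ₁ hθ₂ hδ₀ hδ₁ hθ₀, fun x_inf hx hf => ⟨?_, ?_⟩⟩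
  · exact Rumour.tendstoInProbability_x hlam hγ hθ₁ hθ₂ hδ₀ hδ₁ hθ₀ hθ_le hV hx hf
  · exact Rumour.tendstoInProbability_u hlam hγ hθ₁ hθ₂ hδ₀ hδ₁ hθ₀ hθ_le hV hx hf
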